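/- **Setting.** Let $d\ge 2$, $\omega=e^{2\pi i/d}$, $Z=\sum_{i}\omega^i|i\rangle\langle i|$ and $X=\sum_i|i+1\rangle\langle i|$ (indices modulo $d$) on $\mathbb C^d$. Let $\boldsymbol\alpha=(\alpha_0,\dots,\alpha_{d-1})$ with $\alpha_i>0$ and $\sum_i\alpha_i^2=1$, and put $|\psi(\boldsymbol\alpha)\rangle=\sum_i\alpha_i|i\rangle_A|i\rangle_B\in\mathbb C^d\otimes\mathbb C^d$ and $\rho_B(\boldsymbol\alpha)=\mathrm{Tr}_A|\psi(\boldsymbol\alpha)\rangle\langle\psi(\boldsymbol\alpha)|$. All Hilbert spaces are finite-dimensional. A POVM $\{M_b\}$ is a finite family of positive semidefinite operators with $\sum_b M_b=\mathbb 1$; it is extremal if it is not a proper convex combination of other POVMs with the same outcome set. In the one-sided device-independent (1SDI) scenario trusted Alice holds $\mathbb C^d$, untrusted Bob holds $\mathcal H_B$ and the eavesdropper Eve holds $\mathcal H_E$, where the dimensions of $\mathcal H_B,\mathcal H_E$ are finite but arbitrary. They share a pure state $|\psi_{ABE}\rangle\in\mathbb C^d\otimes\mathcal H_B\otimes\mathcal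 H_E$. Bob has two $d$-outcome POVMs $\{N_{b|0}\}$, $\{N_{b|1}\}$, with generalised observables $B_{k|y}=\sum_b\omega^{kb}N_{b|y}$, and a third POVM $\{R_b\}$ with $d^2$ outcomes. Eve has a POVM $\{E_b\}$ with the same outcome set as $\{R_b\}$. The steering functional is $$I(\boldsymbol\alpha)=\sum_{k=1}^{d-1}\big\langle Z^k\otimes B_{k|0}+\gamma(\boldsymbol\alpha)X^k\otimes B_{k|1}+\delta_k(\boldsymbol\alpha)Z^k\big\rangle,$$ $$\gamma(\boldsymbol\alpha)=d\Big(\sum_{i\ne j}\frac{\alpha_i}{\alpha_j}\Big)^{-1},\qquad \delta_k(\boldsymbol\alpha)=-\frac{\gamma(\boldsymbol\alpha)}{d}\sum_{i\neq j}\frac{\alpha_i}{\alpha_j}\,\omega^{k(d-j)}.$$ The steering inequality is *maximally violated* if $I(\boldsymbol\alpha)$ attains the largest value that it takes over all such states and measurements of Bob. The *POVM-certification conditions* for a reference POVM $\{\mathcal I_b\}$ on $\mathbb C^d$ are $$\langle\psi_{ABE}|X^iZ^j\otimes R_b\otimes\mathbb 1_E|\psi_{ABE}\rangle=\langle\psi(\boldsymbol\alpha)|X^iZ^j\otimes\mathcal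 I_b|\psi(\boldsymbol\alpha)\rangle\qquad\text{for all } b \text{ and } i,j=0,\dots,d-1.$$ Eve's guessing probability is $$G=\sup\ \sum_b\langle\psi_{ABE}|\mathbb 1_A\otimes R_b\otimes E_b|\psi_{ABE}\rangle,$$ the supremum over all $\mathcal H_B,\mathcal H_E$, states and POVMs as above for which the steering inequality is maximally violated and the POVM-certification conditions hold. The number of certified random bits is $-\log_2 G$. **Theorem.** 1. Let $\{\mathcal I_b\}$ be an extremal POVM on $\mathbb C^d$ with $d^2$ outcomes such that $\mathrm{Tr}[\mathcal I_b\,\rho_B(\boldsymbol\alpha)]=1/d^2$ for all $b$. Then the supremum defining $G$ is over a non-empty bounded set, $G=1/d^2$, and hence $2\log_2 d$ bits of randomness are certified. 2. Let $U_{k,l}=X^kZ^l$ and let $|\nu\rangle\in\mathbb C^d$ be a unit vector with $\langle\nu|U_{k,l}^\dagger|\nu\rangle\neq0$ for all $k,l=0,\dots,d-1$. Then $\mathcal I_{k,l}=\frac1d U_{k,l}|\nu\rangle\langle\nu|U_{k,l}^\dagger$ is an extremal POVM with $d^2$ outcomes. For the maximally entangled state, that is $\alpha_i=1/\sqrt d$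 for all $i$, it satisfies $\mathrm{Tr}[\mathcal I_{k,l}\,\rho_B]=1/d^2$ for all $k,l$; consequently $G=1/d^2$, and $2\log_2 d$ bits of randomness are certified. 3. For every $d\ge2$ such a vector $|\nu\rangle$ exists. -/

import Mathlib

open scoped TensorProduct InnerProductSpace ComplexConjugate

noncomputable section

namespace Steering

/-- The `d`-dimensional Hilbert space `ℂ^d` with its computational basis. -/
abbrev Qudit (d : ℕ) : Type := EuclideanSpace ℂ (Fin d)

/-- The computational basis vector `|i⟩`. -/
def ket {d : ℕ} (i : Fin d) : Qudit d := EuclideanSpace.single i (1 : ℂ)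

/-- `ω = exp(2πi/d)`. -/
def omega (d : ℕ) : ℂ := Complex.exp (2 * Real.pi * Complex.I / d)

/-- The operator `|x⟩⟨y|`. -/
def ketbra {H : Type*} [NormedAddCommGroup H] [InnerProductSpace ℂ H] (x y : H) : H →ₗ[ℂ] H :=
  (InnerProductSpace.rankOne ℂ x y : H →L[ℂ] H).toLinearMap

/-- `Z_d = ∑ i, ω^i |i⟩⟨i|`. -/
def Z (d : ℕ) : Qudit d →ₗ[ℂ] Qudit d :=
  ∑ i : Fin d, omega d ^ (i : ℕ) • ketbra (ket i) (ket i)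

/-- `X_d = ∑ i, |i + 1 mod d⟩⟨i|`. -/
def X (d : ℕ) : Qudit d →ₗ[ℂ] Qudit d :=
  ∑ i : Fin d, ketbra (ket (finRotate d i)) (ket i)

/-- A POVM with outcome set `O` on the Hilbert space `H`: positive operators summing to `1`. -/
def IsPOVM {O H : Type*} [Fintype O] [NormedAddCommGroup H] [InnerProductSpace ℂ H]
    (M : O → H →ₗ[ℂ] H) : Prop :=
  (∀ b, (M b).IsPositive) ∧ ∑ b, M b = 1

/-- A POVM is extremal if it is not a proper convex combination of other POVMs with the same
outcome set. -/
def IsExtremalPOVM {O H : Type*} [Fintype O] [NormedAddCommGroup H] [InnerProductSpace ℂ H]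
    (M : O → H →ₗ[ℂ] H) : Prop :=
  M ∈ Set.extremePoints ℝ {N : O → H →ₗ[ℂ] H | IsPOVM N}

/-- The generalised observables of a `d`-outcome measurement: `∑ b, ω^(k b) M_b`. -/
def genObs {d : ℕ} {H : Type*} [NormedAddCommGroup H] [InnerProductSpace ℂ H]
    (M : Fin d → H →ₗ[ℂ] H) (k : ℕ) : H →ₗ[ℂ] H :=
  ∑ b : Fin d, omega d ^ (k * (b : ℕ)) • M b

/-- The expectation value `⟨ψ|T|ψ⟩`. -/
def expect {H : Type*} [NormedAddCommGroup H] [InnerProductSpace ℂ H]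
    (ψ : H) (T : H →ₗ[ℂ] H) : ℂ := ⟪ψ, T ψ⟫_ℂ

/-- The operator `S ⊗ T ⊗ V` on `ℋ_A ⊗ ℋ_B ⊗ ℋ_E` with `ℋ_A = ℂ^d`. -/
def tri {d : ℕ} {HB HE : Type*} [NormedAddCommGroup HB] [InnerProductSpace ℂ HB]
    [NormedAddCommGroup HE] [InnerProductSpace ℂ HE]
    (S : Qudit d →ₗ[ℂ] Qudit d) (T : HB →ₗ[ℂ] HB) (V : HE →ₗ[ℂ] HE) :
    (Qudit d ⊗[ℂ] (HB ⊗[ℂ] HE)) →ₗ[ℂ] (Qudit d ⊗[ℂ] (HB ⊗[ℂ] HE)) :=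
  TensorProduct.map S (TensorProduct.map T V)

/-- `∑_{i ≠ j} α_i / α_j`. -/
def ratioSum {d : ℕ} (α : Fin d → ℝ) : ℝ :=
  ∑ i : Fin d, ∑ j : Fin d, if i ≠ j then α i / α j else 0

/-- `γ(α) = d (∑_{i ≠ j} α_i / α_j)⁻¹`. -/
def gammaCoeff {d : ℕ} (α : Fin d → ℝ) : ℝ := d * (ratioSum α)⁻¹

/-- `δ_k(α) = -(γ(α)/d) ∑_{i ≠ j} (α_i / α_j) ω^(k (d - j))`. -/
def deltaCoeff {d : ℕ} (α : Fin d → ℝ) (k : ℕ) : ℂ :=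
  -((gammaCoeff α / d : ℝ) : ℂ) *
    ∑ i : Fin d, ∑ j : Fin d,
      if i ≠ j then ((α i / α j : ℝ) : ℂ) * omega d ^ (k * (d - (j : ℕ))) else 0

/-- A quantum realisation of the steering experiment: a pure state of Alice, Bob and an external
system `E` (purifying the state of Alice and Bob), together with Bob's two `d`-outcome
measurements. -/
structure Realization (d : ℕ) (HB HE : Type*)
    [NormedAddCommGroup HB] [InnerProductSpace ℂ HB]
    [NormedAddCommGroup HE] [InnerProductSpace ℂ HE] where
  /-- the shared state `|ψ_ABE⟩` -/
  ψ : Qudit d ⊗[ℂ] (HB ⊗[ℂ] HE)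
  norm_ψ : ‖ψ‖ = 1
  /-- Bob's measurement for the input `0` -/
  B₀ : Fin d → HB →ₗ[ℂ] HB
  /-- Bob's measurement for the input `1` -/
  B₁ : Fin d → HB →ₗ[ℂ] HB
  povm_B₀ : IsPOVM B₀
  povm_B₁ : IsPOVM B₁

/-- The value of the steering functional
`∑_{k=1}^{d-1} ⟨A₀^k ⊗ B_{k|0} + γ(α) A₁^k ⊗ B_{k|1} + δ_k(α) A₀^k⟩`, `A₀ = Z_d`, `A₁ = X_d`.
The sum is a real number. -/
def Realization.value {d : ℕ} {HB HE : Type*}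
    [NormedAddCommGroup HB] [InnerProductSpace ℂ HB]
    [NormedAddCommGroup HE] [InnerProductSpace ℂ HE]
    (r : Realization d HB HE) (α : Fin d → ℝ) : ℝ :=
  (∑ k ∈ Finset.Ico 1 d,
    (expect r.ψ (tri (Z d ^ k) (genObs r.B₀ k) 1)
      + (gammaCoeff α : ℂ) * expect r.ψ (tri (X d ^ k) (genObs r.B₁ k) 1)
      + deltaCoeff α k * expect r.ψ (tri (Z d ^ k) 1 1))).re

/-- All values of the steering functional that are attainable in quantum theory, with
finite-dimensional systems of arbitrary dimension. -/
def quantumValues {d : ℕ} (α : Fin d → ℝ) : Set ℝ :=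
  {v | ∃ (HB HE : Type) (_ : NormedAddCommGroup HB) (_ : InnerProductSpace ℂ HB)
      (_ : NormedAddCommGroup HE) (_ : InnerProductSpace ℂ HE)
      (_ : FiniteDimensional ℂ HB) (_ : FiniteDimensional ℂ HE)
      (r : Realization d HB HE), v = r.value α}

/-- The realisation violates the steering inequality maximally: the functional attains the largest
value possible in quantum theory. -/
def Realization.ViolatesMaximally {d : ℕ} {HB HE : Type*}
    [NormedAddCommGroup HB] [InnerProductSpace ℂ HB]
    [NormedAddCommGroup HE] [InnerProductSpace ℂ HE]
    (r : Realization d HB HE) (α : Fin d → ℝ) : Prop :=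
  IsGreatest (quantumValues α) (r.value α)

/-- The target state `|ψ(α)⟩ = ∑ i, α_i |i⟩|i⟩`. -/
def idealState {d : ℕ} (α : Fin d → ℝ) : Qudit d ⊗[ℂ] Qudit d :=
  ∑ i : Fin d, (α i : ℂ) • (ket i ⊗ₜ[ℂ] ket i)

/-- The partial inner product `(⟨i| ⊗ 1) ψ`. -/
def partialBra {d : ℕ} (i : Fin d) (ψ : Qudit d ⊗[ℂ] Qudit d) : Qudit d :=
  TensorProduct.lid ℂ (Qudit d) (TensorProduct.map (innerₛₗ ℂ (ket i)) LinearMap.id ψ)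

/-- The partial trace over `A` of `|ψ⟩⟨ψ|`: `∑ i, (⟨i| ⊗ 1)|ψ⟩⟨ψ|(|i⟩ ⊗ 1)`. -/
def reducedState {d : ℕ} (ψ : Qudit d ⊗[ℂ] Qudit d) : Qudit d →ₗ[ℂ] Qudit d :=
  ∑ i : Fin d, ketbra (partialBra i ψ) (partialBra i ψ)

/-- A strategy in the presence of the eavesdropper Eve, who holds the system `E`: a realisation of
the steering experiment, the POVM `R` that Bob's device performs for his third input, and a POVM of
Eve, whose outcome is her guess of Bob's outcome. -/
structure Strategy (d : ℕ) (O HB HE : Type*) [Fintype O]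
    [NormedAddCommGroup HB] [InnerProductSpace ℂ HB]
    [NormedAddCommGroup HE] [InnerProductSpace ℂ HE] extends Realization d HB HE where
  /-- Bob's POVM for his third input -/
  R : O → HB →ₗ[ℂ] HB
  /-- Eve's POVM -/
  E : O → HE →ₗ[ℂ] HE
  povm_R : IsPOVM R
  povm_E : IsPOVM E

namespace Strategy

variable {d : ℕ} {O HB HE : Type*} [Fintype O]
    [NormedAddCommGroup HB] [InnerProductSpace ℂ HB]
    [NormedAddCommGroup HE] [InnerProductSpace ℂ HE]

/-- The conditions for the certification of the POVM: the statistics of `R` together with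
`X^i Z^j` on Alice's side are those of the reference POVM `I` on the state `|ψ(α)⟩`. -/
def MatchesPOVM (s : Strategy d O HB HE) (α : Fin d → ℝ) (I : O → Qudit d →ₗ[ℂ] Qudit d) : Prop :=
  ∀ (b : O) (i j : Fin d),
    expect s.ψ (tri (X d ^ (i : ℕ) * Z d ^ (j : ℕ)) (s.R b) 1)
      = expect (idealState α) (TensorProduct.map (X d ^ (i : ℕ) * Z d ^ (j : ℕ)) (I b))

/-- The probability that Eve's outcome equals Bob's outcome, `∑ b, ⟨ψ|1 ⊗ R_b ⊗ E_b|ψ⟩`. -/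
def guess (s : Strategy d O HB HE) : ℝ :=
  (∑ b, expect s.ψ (tri 1 (s.R b) (s.E b))).re

end Strategy

/-- The guessing probabilities of all strategies that are compatible with the maximal violation of
the steering inequality and the POVM-certification conditions. -/
def guessValues {d : ℕ} {O : Type*} [Fintype O] (α : Fin d → ℝ)
    (I : O → Qudit d →ₗ[ℂ] Qudit d) : Set ℝ :=
  {g | ∃ (HB HE : Type) (_ : NormedAddCommGroup HB) (_ : InnerProductSpace ℂ HB)
      (_ : NormedAddCommGroup HE) (_ : InnerProductSpace ℂ HE)
      (_ : FiniteDimensional ℂ HB) (_ : FiniteDimensional ℂ HE)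
      (s : Strategy d O HB HE),
      s.ViolatesMaximally α ∧ s.MatchesPOVM α I ∧ g = s.guess}

/-- Eve's guessing probability `G`, the supremum over all compatible strategies. -/
def guessingProbability {d : ℕ} {O : Type*} [Fintype O] (α : Fin d → ℝ)
    (I : O → Qudit d →ₗ[ℂ] Qudit d) : ℝ :=
  sSup (guessValues α I)

/-- The number of certified random bits: the min-entropy `-log₂ G`. -/
def certifiedBits {d : ℕ} {O : Type*} [Fintype O] (α : Fin d → ℝ)
    (I : O → Qudit d →ₗ[ℂ] Qudit d) : ℝ :=
  -Real.logb 2 (guessingProbability α I)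

/-- The unitaries `U_{k,l} = X_d^k Z_d^l`. -/
def U {d : ℕ} (k l : Fin d) : Qudit d →ₗ[ℂ] Qudit d := X d ^ (k : ℕ) * Z d ^ (l : ℕ)

/-- The Weyl-covariant POVM `(1/d) U_{k,l} |ν⟩⟨ν| U_{k,l}†`. -/
def weylPOVM {d : ℕ} (ν : Qudit d) (b : Fin d × Fin d) : Qudit d →ₗ[ℂ] Qudit d :=
  (1 / d : ℂ) • (U b.1 b.2 ∘ₗ ketbra ν ν ∘ₗ LinearMap.adjoint (U b.1 b.2))

/-- `⟨ν|U_{k,l}†|ν⟩ ≠ 0` for all `k, l`, for a unit vector `ν`. -/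
def IsWeylFiducial {d : ℕ} (ν : Qudit d) : Prop :=
  ‖ν‖ = 1 ∧ ∀ k l : Fin d, expect ν (LinearMap.adjoint (U k l)) ≠ 0

/-- The Schmidt coefficients of the maximally entangled state `(1/√d) ∑ i, |i⟩|i⟩`. -/
def maxEntangled (d : ℕ) : Fin d → ℝ := fun _ => 1 / Real.sqrt d

end Steering

end

/-!
Write the shared state as `∑ i, α_i |i⟩ ⊗ ξ_i`, with `ξ_i` in the Hilbert space of Bob and Eve.
Completing squares, the steering functional is `d` minus two nonnegative defects. It is maximal,
with value `d`, exactly if Bob's measurements `A = B₀` and `C = B₁` are perfectly correlated with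
Alice's computational and Fourier bases, that is `A_{-i} ξ_i = ξ_i` and `C_b ξ_j = ω^(b j) C_b ξ_0`.

*Decoupling.* An operator of Eve commutes with both measurements of Bob, so the first relation makes
its matrix `⟨ξ_i|1 ⊗ V|ξ_j⟩` diagonal and the second one makes the diagonal constant. The compressed
operators `M_{c,b} = (⟨ξ_i|R_b ⊗ E_c|ξ_j⟩)_{i,j}` on `ℂ^d` are positive, their sum over `b` is a
scalar `q_c`, and their sum over `c` is `I_b`, because the operators `X^k Z^l` span all operators on
`ℂ^d` and the certification conditions therefore determine the compression of `R_b`. So `I` is the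
sum over `c` of the families `M_c`, and extremality forces `M_{c,b} = q_c I_b`. Hence Eve guesses
correctly with probability `∑ b, q_b Tr[I_b ρ_B] ≤ max_b Tr[I_b ρ_B]`, and she attains this bound by
always announcing the most likely outcome of the ideal devices.

*The Weyl-covariant POVM.* A POVM of linearly independent rank-one operators is extremal.
Conjugation by `U_{k,l}` multiplies `U_{m,n}` by a character of `(k, l)`, so that the overlaps
`Tr[U_{m,n}† I_{k,l}]` are multiples of characters by the nonzero numbers `⟨ν|U_{m,n}†|ν⟩ / d`;
linear independence then follows from that of characters.

*Fiducial vectors.* For `ν` proportional to `∑ i, s^i |i⟩`, the number `⟨ν|U_{k,l}†|ν⟩` is a sum of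
two geometric series. If it vanishes and `1 < |s|`, then comparing absolute values gives `d = 2 k`,
and squaring shows that `s^d` is real; the choice `s^d = 2i` excludes this.
-/

noncomputable section

namespace Steering

section Characters

variable {d : ℕ} [NeZero d]

lemma isPrimitiveRoot_omega : IsPrimitiveRoot (omega d) d :=
  Complex.isPrimitiveRoot_exp d (NeZero.ne d)

/-- The character `j ↦ ω^(k j)` of `ℤ/d`. -/
def phase (k : Fin d) : AddChar (Fin d) ℂ where
  toFun j := omega d ^ ((k : ℕ) * (j : ℕ))
  map_zero_eq_one' := by simp
  map_add_eq_mul' i j := by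
    rw [← pow_add, ← mul_add, pow_mul', pow_mul', Fin.val_add,
      ← pow_eq_pow_mod _ isPrimitiveRoot_omega.pow_eq_one]

lemma phase_apply (k j : Fin d) : phase k j = omega d ^ ((k : ℕ) * (j : ℕ)) := rfl

lemma phase_comm (k j : Fin d) : phase k j = phase j k := by
  rw [phase_apply, phase_apply, mul_comm]

lemma phase_zero_left (j : Fin d) : phase 0 j = 1 := by simp [phase_apply]

lemma phase_neg (k j : Fin d) : phase k (-j) = conj (phase k j) := AddChar.map_neg_eq_conj _ _

lemma phase_mul_conj (k j : Fin d) : phase k j * conj (phase k j) = 1 := by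
  rw [← phase_neg, ← AddChar.map_add_eq_mul, add_neg_cancel, AddChar.map_zero_eq_one]

lemma conj_mul_phase (k j : Fin d) : conj (phase k j) * phase k j = 1 := by
  rw [mul_comm, phase_mul_conj]

lemma phase_injective : Function.Injective (phase (d := d)) := by
  intro i j h
  rcases (Nat.one_le_iff_ne_zero.2 (NeZero.ne d)).eq_or_lt with hd | hd
  · subst hd
    exact Subsingleton.elim i j
  · have hval : ((1 : Fin d) : ℕ) = 1 := by rw [Fin.val_one', Nat.mod_eq_of_lt hd]
    have h1 : phase i 1 = phase j 1 := by rw [h]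
    simp only [phase_apply, hval, mul_one] at h1
    exact Fin.ext (isPrimitiveRoot_omega.pow_inj i.2 j.2 h1)

lemma sum_phase_mul_conj (i j : Fin d) :
    ∑ k, phase k i * conj (phase k j) = if i = j then (d : ℂ) else 0 := by
  classical
  have hchar : ∀ k, phase k i * conj (phase k j) = (phase i - phase j) k := fun k => by
    rw [AddChar.sub_apply, AddChar.map_neg_eq_conj, phase_comm i, phase_comm j]
  simp only [hchar, AddChar.sum_eq_ite, sub_eq_zero, phase_injective.eq_iff, Fintype.card_fin]

lemma eq_zero_of_sum_phase_mul_eq_zero {f : Fin d → ℂ} (h : ∀ k, ∑ i, phase k i * f i = 0) :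
    f = 0 := by
  have hli := (AddChar.linearIndependent (Fin d) ℂ).comp _ (phase_injective (d := d))
  refine funext (Fintype.linearIndependent_iff.1 hli f (funext fun k => ?_))
  simpa [mul_comm, phase_comm k] using h k

end Characters

section Qudit

variable {d : ℕ}

lemma inner_ket (i : Fin d) (x : Qudit d) : ⟪ket i, x⟫_ℂ = x i := by
  simp [ket, EuclideanSpace.inner_single_left]

lemma ket_apply (i j : Fin d) : ket i j = if j = i then (1 : ℂ) else 0 := by
  simp [ket]

lemma norm_ket (i : Fin d) : ‖ket i‖ = 1 := by simp [ket]

lemma inner_ket_ket (i j : Fin d) : ⟪ket i, ket j⟫_ℂ = if i = j then 1 else 0 := by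
  rw [inner_ket, ket_apply]

lemma sum_smul_ket (x : Qudit d) : ∑ i, x i • ket i = x := by
  ext j
  simp [ket_apply]

lemma linearMap_ext_ket {M : Type*} [AddCommGroup M] [Module ℂ M] {S T : Qudit d →ₗ[ℂ] M}
    (h : ∀ i, S (ket i) = T (ket i)) : S = T := by
  ext x
  rw [← sum_smul_ket x]
  simp only [map_sum, map_smul, h]

lemma linearMap_ext_inner_ket {S T : Qudit d →ₗ[ℂ] Qudit d}
    (h : ∀ i j, ⟪ket i, S (ket j)⟫_ℂ = ⟪ket i, T (ket j)⟫_ℂ) : S = T := by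
  refine linearMap_ext_ket fun j => ?_
  ext i
  simpa only [inner_ket] using h i j

lemma ketbra_apply {H : Type*} [NormedAddCommGroup H] [InnerProductSpace ℂ H] (x y z : H) :
    ketbra x y z = ⟪y, z⟫_ℂ • x := rfl

lemma Z_ket (i : Fin d) : Z d (ket i) = omega d ^ (i : ℕ) • ket i := by
  simp [Z, ketbra_apply, inner_ket, ket_apply]

lemma Z_pow_apply_ket (k : ℕ) (i : Fin d) :
    (Z d ^ k) (ket i) = omega d ^ (k * (i : ℕ)) • ket i := by
  induction k with
  | zero => simp
  | succ k ih =>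
    rw [pow_succ', Module.End.mul_apply, ih, map_smul, Z_ket, smul_smul, ← pow_add, add_one_mul]

variable [NeZero d]

lemma Z_pow_ket (k i : Fin d) : (Z d ^ (k : ℕ)) (ket i) = phase k i • ket i :=
  Z_pow_apply_ket k i

lemma X_ket (i : Fin d) : X d (ket i) = ket (i + 1) := by
  simp [X, ketbra_apply, inner_ket, ket_apply, finRotate_apply]

lemma X_pow_ket (k i : Fin d) : (X d ^ (k : ℕ)) (ket i) = ket (i + k) := by
  have hnat : ∀ n : ℕ, (X d ^ n) (ket i) = ket (i + Fin.ofNat d n) := by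
    intro n
    induction n with
    | zero => simp
    | succ n ih =>
      rw [pow_succ', Module.End.mul_apply, ih, X_ket]
      congr 1
      ext
      simp [Fin.val_add, add_assoc]
  simp [hnat]

lemma U_ket (k l i : Fin d) : U k l (ket i) = phase l i • ket (i + k) := by
  rw [U, Module.End.mul_apply, Z_pow_ket, map_smul, X_pow_ket]

lemma eq_zero_of_sum_inner_U_mul_eq_zero {F : Fin d → Fin d → ℂ}
    (h : ∀ k l, ∑ i, ∑ j, ⟪ket i, U k l (ket j)⟫_ℂ * F i j = 0) : F = 0 := by
  ext i j
  have hdiag : (fun m => F (m + (i - j)) m) = 0 := by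
    refine eq_zero_of_sum_phase_mul_eq_zero fun l => ?_
    have hl := h (i - j) l
    rw [Finset.sum_comm] at hl
    simpa only [U_ket, inner_smul_right, inner_ket_ket, mul_ite, mul_one, mul_zero, ite_mul,
      zero_mul, Finset.sum_ite_eq', Finset.mem_univ, if_true] using hl
  simpa using congrFun hdiag j

end Qudit

section Components

variable {d : ℕ} {K : Type*} [NormedAddCommGroup K] [InnerProductSpace ℂ K]

/-- The component `(⟨i| ⊗ 1) ψ` of a vector of `ℂ^d ⊗ K`, the analogue of `partialBra` for an
arbitrary second factor. -/
def component (i : Fin d) : Qudit d ⊗[ℂ] K →ₗ[ℂ] K :=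
  (TensorProduct.lid ℂ K).toLinearMap ∘ₗ TensorProduct.map (innerₛₗ ℂ (ket i)) LinearMap.id

lemma component_tmul (i : Fin d) (x : Qudit d) (y : K) : component i (x ⊗ₜ[ℂ] y) = x i • y := by
  simp [component, inner_ket]

lemma sum_ket_tmul_component (ψ : Qudit d ⊗[ℂ] K) : ∑ i, ket i ⊗ₜ[ℂ] component i ψ = ψ := by
  induction ψ using TensorProduct.induction_on with
  | zero => simp
  | tmul x y =>
    simp only [component_tmul, ← TensorProduct.smul_tmul, ← TensorProduct.sum_tmul, sum_smul_ket]
  | add x y hx hy =>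
    simp only [map_add, TensorProduct.tmul_add, Finset.sum_add_distrib, hx, hy]

lemma component_idealState (α : Fin d → ℝ) (i : Fin d) :
    component i (idealState α) = (α i : ℂ) • ket i := by
  simp [idealState, component_tmul, ket_apply]

lemma expect_map (ψ : Qudit d ⊗[ℂ] K) (S : Qudit d →ₗ[ℂ] Qudit d) (T : K →ₗ[ℂ] K) :
    expect ψ (TensorProduct.map S T)
      = ∑ i, ∑ j, ⟪ket i, S (ket j)⟫_ℂ * ⟪component i ψ, T (component j ψ)⟫_ℂ := by
  conv_lhs => rw [← sum_ket_tmul_component ψ]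
  simp only [expect, map_sum, TensorProduct.map_tmul, sum_inner, inner_sum,
    TensorProduct.inner_tmul]
  rw [Finset.sum_comm]

lemma expect_map_one (ψ : Qudit d ⊗[ℂ] K) (T : K →ₗ[ℂ] K) :
    expect ψ (TensorProduct.map 1 T) = ∑ i, ⟪component i ψ, T (component i ψ)⟫_ℂ := by
  simp [expect_map, inner_ket_ket]

lemma sum_inner_component_self (ψ : Qudit d ⊗[ℂ] K) :
    ∑ i, ⟪component i ψ, component i ψ⟫_ℂ = ⟪ψ, ψ⟫_ℂ := by
  simpa [expect] using (expect_map_one ψ 1).symm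

lemma trace_comp_ketbra {H : Type*} [NormedAddCommGroup H] [InnerProductSpace ℂ H]
    [FiniteDimensional ℂ H] (T : H →ₗ[ℂ] H) (x y : H) :
    LinearMap.trace ℂ H (T ∘ₗ ketbra x y) = ⟪y, T x⟫_ℂ := by
  have hcomp : T ∘ₗ ketbra x y = ketbra (T x) y := LinearMap.ext fun z => by simp [ketbra_apply]
  rw [hcomp]
  exact InnerProductSpace.trace_rankOne _ _

lemma trace_comp_reducedState (ψ : Qudit d ⊗[ℂ] Qudit d) (T : Qudit d →ₗ[ℂ] Qudit d) :
    LinearMap.trace ℂ (Qudit d) (T ∘ₗ reducedState ψ) = expect ψ (TensorProduct.map 1 T) := by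
  rw [expect_map_one, reducedState, ← Module.End.mul_eq_comp, Finset.mul_sum, map_sum]
  exact Finset.sum_congr rfl fun i _ => trace_comp_ketbra _ _ _

lemma eq_of_expect_U_idealState_eq [NeZero d] {α : Fin d → ℝ} (hα : ∀ i, α i ≠ 0)
    {S T : Qudit d →ₗ[ℂ] Qudit d}
    (h : ∀ k l, expect (idealState α) (TensorProduct.map (U k l) S)
      = expect (idealState α) (TensorProduct.map (U k l) T)) : S = T := by
  have hzero := eq_zero_of_sum_inner_U_mul_eq_zero
    (F := fun i j => ((α i : ℂ) * α j) * (⟪ket i, S (ket j)⟫_ℂ - ⟪ket i, T (ket j)⟫_ℂ))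
    fun k l => by
      have hkl := sub_eq_zero.2 (h k l)
      simp only [expect_map, component_idealState, map_smul, inner_smul_left, inner_smul_right,
        Complex.conj_ofReal, ← Finset.sum_sub_distrib] at hkl
      rw [← hkl]
      exact Finset.sum_congr rfl fun i _ => Finset.sum_congr rfl fun j _ => by ring
  refine linearMap_ext_inner_ket fun i j => sub_eq_zero.1 ?_
  refine (mul_eq_zero.1 (congrFun (congrFun hzero i) j)).resolve_left ?_
  exact mul_ne_zero (Complex.ofReal_ne_zero.2 (hα i)) (Complex.ofReal_ne_zero.2 (hα j))

end Components

section Compression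

variable {d : ℕ} {K : Type*} [NormedAddCommGroup K] [InnerProductSpace ℂ K]

/-- The linear map `ℂ^d → K` that sends `|i⟩` to `ξ_i`. -/
def ketMap (ξ : Fin d → K) : Qudit d →ₗ[ℂ] K := ∑ i, (innerₛₗ ℂ (ket i)).smulRight (ξ i)

lemma ketMap_ket (ξ : Fin d → K) (i : Fin d) : ketMap ξ (ket i) = ξ i := by
  simp [ketMap, inner_ket_ket]

/-- The vectors `ξ_i` for which `ψ = ∑ i, α_i |i⟩ ⊗ ξ_i`. -/
def relativeComponent (α : Fin d → ℝ) (ψ : Qudit d ⊗[ℂ] K) (i : Fin d) : K :=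
  (α i : ℂ)⁻¹ • component i ψ

lemma smul_relativeComponent {α : Fin d → ℝ} {i : Fin d} (hα : α i ≠ 0) (ψ : Qudit d ⊗[ℂ] K) :
    (α i : ℂ) • relativeComponent α ψ i = component i ψ :=
  smul_inv_smul₀ (Complex.ofReal_ne_zero.2 hα) _

lemma map_ketMap_idealState {α : Fin d → ℝ} (hα : ∀ i, α i ≠ 0) (ψ : Qudit d ⊗[ℂ] K) :
    TensorProduct.map 1 (ketMap (relativeComponent α ψ)) (idealState α) = ψ := by
  simp only [idealState, map_sum, map_smul, TensorProduct.map_tmul, Module.End.one_apply,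
    ketMap_ket, ← TensorProduct.tmul_smul, smul_relativeComponent (hα _), sum_ket_tmul_component]

variable [FiniteDimensional ℂ K]

/-- The operator on `ℂ^d` with the matrix `⟨ξ_i|T|ξ_j⟩`. -/
def compression (ξ : Fin d → K) (T : K →ₗ[ℂ] K) : Qudit d →ₗ[ℂ] Qudit d :=
  LinearMap.adjoint (ketMap ξ) ∘ₗ T ∘ₗ ketMap ξ

lemma inner_compression (ξ : Fin d → K) (T : K →ₗ[ℂ] K) (i j : Fin d) :
    ⟪ket i, compression ξ T (ket j)⟫_ℂ = ⟪ξ i, T (ξ j)⟫_ℂ := by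
  simp [compression, LinearMap.adjoint_inner_right, ketMap_ket]

lemma compression_sum {ι : Type*} [Fintype ι] (ξ : Fin d → K) (T : ι → K →ₗ[ℂ] K) :
    compression ξ (∑ b, T b) = ∑ b, compression ξ (T b) := by
  ext1 x
  simp [compression]

lemma isPositive_compression {T : K →ₗ[ℂ] K} (hT : T.IsPositive) (ξ : Fin d → K) :
    (compression ξ T).IsPositive :=
  hT.adjoint_conj _

lemma expect_map_eq_compression {α : Fin d → ℝ} (hα : ∀ i, α i ≠ 0) (ψ : Qudit d ⊗[ℂ] K)
    (S : Qudit d →ₗ[ℂ] Qudit d) (T : K →ₗ[ℂ] K) :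
    expect ψ (TensorProduct.map S T)
      = expect (idealState α) (TensorProduct.map S (compression (relativeComponent α ψ) T)) := by
  conv_lhs => rw [← map_ketMap_idealState hα ψ]
  rw [expect, ← LinearMap.adjoint_inner_right, TensorProduct.adjoint_map, LinearMap.adjoint_one,
    ← LinearMap.comp_apply, ← LinearMap.comp_apply, ← TensorProduct.map_comp,
    ← TensorProduct.map_comp]
  rfl

end Compression

section PositiveOperators

variable {H K : Type*} [NormedAddCommGroup H] [InnerProductSpace ℂ H] [FiniteDimensional ℂ H]
  [NormedAddCommGroup K] [InnerProductSpace ℂ K]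

lemma isPositive_ketbra (x : H) : (ketbra x x).IsPositive := by
  have := FiniteDimensional.complete ℂ H
  exact (ContinuousLinearMap.isPositive_toLinearMap_iff _).2
    (InnerProductSpace.isPositive_rankOne_self x)

lemma exists_eq_sum_ketbra {T : H →ₗ[ℂ] H} (hT : T.IsPositive) :
    ∃ (n : ℕ) (u : Fin n → H), T = ∑ i, ketbra (u i) (u i) := by
  obtain ⟨n, u, hu⟩ := ContinuousLinearMap.isPositive_iff_eq_sum_rankOne.1
    ((LinearMap.isPositive_toContinuousLinearMap_iff T).2 hT)
  refine ⟨n, u, ?_⟩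
  simpa [ketbra] using congrArg (fun f : H →L[ℂ] H => f.toLinearMap) hu

lemma map_ketbra {H : Type*} [NormedAddCommGroup H] [InnerProductSpace ℂ H] (x : H) (y : K) :
    TensorProduct.map (ketbra x x) (ketbra y y) = ketbra (x ⊗ₜ[ℂ] y) (x ⊗ₜ[ℂ] y) := by
  ext a b
  simp [ketbra_apply, TensorProduct.smul_tmul', TensorProduct.tmul_smul, smul_smul, mul_comm]

lemma isPositive_map [FiniteDimensional ℂ K] {S : H →ₗ[ℂ] H} {T : K →ₗ[ℂ] K}
    (hS : S.IsPositive) (hT : T.IsPositive) : (TensorProduct.map S T).IsPositive := by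
  obtain ⟨n, u, rfl⟩ := exists_eq_sum_ketbra hS
  obtain ⟨m, v, rfl⟩ := exists_eq_sum_ketbra hT
  simp only [← TensorProduct.mapBilinear_apply, map_sum, LinearMap.sum_apply]
  simp only [TensorProduct.mapBilinear_apply, map_ketbra]
  exact LinearMap.isPositive_sum _ fun j _ => LinearMap.isPositive_sum _ fun i _ =>
    isPositive_ketbra _

lemma apply_eq_zero_of_re_inner_eq_zero {T : H →ₗ[ℂ] H} (hT : T.IsPositive) {x : H}
    (hx : RCLike.re ⟪x, T x⟫_ℂ = 0) : T x = 0 := by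
  obtain ⟨n, u, rfl⟩ := exists_eq_sum_ketbra hT
  have hterm : ∀ i, RCLike.re ⟪x, ketbra (u i) (u i) x⟫_ℂ = ‖⟪u i, x⟫_ℂ‖ ^ 2 := fun i => by
    rw [ketbra_apply, inner_smul_right, inner_mul_symm_re_eq_norm, norm_mul, norm_inner_symm x, sq]
  simp only [LinearMap.sum_apply, inner_sum, map_sum, hterm] at hx
  rw [Finset.sum_eq_zero_iff_of_nonneg fun _ _ => by positivity] at hx
  simp only [LinearMap.sum_apply, ketbra_apply]
  refine Finset.sum_eq_zero fun i hi => ?_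
  rw [norm_eq_zero.1 (pow_eq_zero_iff two_ne_zero |>.1 (hx i hi)), zero_smul]

end PositiveOperators

section POVM

variable {O H K : Type*} [Fintype O] [NormedAddCommGroup H] [InnerProductSpace ℂ H]
  [NormedAddCommGroup K] [InnerProductSpace ℂ K] {M : O → H →ₗ[ℂ] H}

lemma IsPOVM.nonempty [Nontrivial H] (hM : IsPOVM M) : Nonempty O := by
  by_contra hempty
  rw [not_nonempty_iff] at hempty
  exact zero_ne_one (Fintype.sum_empty M ▸ hM.2)

lemma IsPOVM.sum_apply (hM : IsPOVM M) (x : H) : ∑ b, M b x = x := by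
  rw [← LinearMap.sum_apply, hM.2, Module.End.one_apply]

lemma IsPOVM.sum_inner_apply (hM : IsPOVM M) (x y : H) : ∑ b, ⟪x, M b y⟫_ℂ = ⟪x, y⟫_ℂ := by
  rw [← inner_sum, hM.sum_apply]

lemma IsPOVM.isPositive_one_sub (hM : IsPOVM M) (b : O) : (1 - M b).IsPositive := by
  classical
  rw [← hM.2, ← Finset.sum_erase_add _ _ (Finset.mem_univ b), add_sub_cancel_right]
  exact LinearMap.isPositive_sum _ fun c _ => hM.1 c

lemma IsPOVM.sum_map_left (hM : IsPOVM M) (V : K →ₗ[ℂ] K) :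
    ∑ b, TensorProduct.map (M b) V = TensorProduct.map 1 V := by
  simp only [← TensorProduct.mapBilinear_apply, ← LinearMap.sum_apply, ← map_sum, hM.2]

lemma IsPOVM.sum_map_right (hM : IsPOVM M) (V : K →ₗ[ℂ] K) :
    ∑ b, TensorProduct.map V (M b) = TensorProduct.map V 1 := by
  simp only [← TensorProduct.mapBilinear_apply, ← map_sum, hM.2]

lemma IsPOVM.map_one [FiniteDimensional ℂ H] [FiniteDimensional ℂ K] (hM : IsPOVM M) :
    IsPOVM fun b => TensorProduct.map (M b) (1 : K →ₗ[ℂ] K) := by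
  refine ⟨fun b => isPositive_map (hM.1 b) LinearMap.isPositive_one, ?_⟩
  rw [hM.sum_map_left, TensorProduct.map_one]

lemma IsPOVM.apply_eq_zero_of_apply_eq_self [FiniteDimensional ℂ H] (hM : IsPOVM M) {b c : O}
    (hbc : b ≠ c) {x : H} (hx : M c x = x) : M b x = 0 := by
  classical
  have hsum : ∑ a ∈ Finset.univ.erase c, RCLike.re ⟪x, M a x⟫_ℂ = 0 := by
    have h := congrArg RCLike.re (hM.sum_inner_apply x x)
    rw [map_sum, ← Finset.sum_erase_add _ _ (Finset.mem_univ c), hx] at h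
    linarith
  rw [Finset.sum_eq_zero_iff_of_nonneg fun a _ => (hM.1 a).re_inner_nonneg_right x] at hsum
  exact apply_eq_zero_of_re_inner_eq_zero (hM.1 b)
    (hsum b (Finset.mem_erase.2 ⟨hbc, Finset.mem_univ b⟩))

end POVM

section SteeringCoefficients

variable {d : ℕ}

/-- The sum `∑_{i ≠ l} α_i / α_l`, which is the coefficient of `ω^(k (d - l))` in `deltaCoeff`. -/
def rowRatio (α : Fin d → ℝ) (l : Fin d) : ℝ := ∑ i, if i ≠ l then α i / α l else 0

lemma sum_rowRatio (α : Fin d → ℝ) : ∑ l, rowRatio α l = ratioSum α := Finset.sum_comm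

lemma rowRatio_add_one {α : Fin d → ℝ} {l : Fin d} (hα : α l ≠ 0) :
    rowRatio α l + 1 = (∑ i, α i) / α l := by
  rw [rowRatio, ← Finset.sum_filter, Finset.filter_ne', Finset.sum_div,
    ← Finset.sum_erase_add _ _ (Finset.mem_univ l), div_self hα]

lemma ratioSum_pos {α : Fin d → ℝ} (hd : 2 ≤ d) (hα : ∀ i, 0 < α i) : 0 < ratioSum α := by
  have : Nontrivial (Fin d) := Fin.nontrivial_iff_two_le.2 hd
  obtain ⟨i, j, hij⟩ := exists_pair_ne (Fin d)
  have hnonneg : ∀ i j, 0 ≤ if i ≠ j then α i / α j else 0 := fun i j => by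
    split_ifs
    · exact (div_pos (hα i) (hα j)).le
    · exact le_rfl
  refine Finset.sum_pos' (fun i _ => Finset.sum_nonneg fun j _ => hnonneg i j)
    ⟨i, Finset.mem_univ i, Finset.sum_pos' (fun j _ => hnonneg i j) ⟨j, Finset.mem_univ j, ?_⟩⟩
  rw [if_pos hij]
  exact div_pos (hα i) (hα j)

lemma gammaCoeff_pos {α : Fin d → ℝ} (hd : 2 ≤ d) (hα : ∀ i, 0 < α i) : 0 < gammaCoeff α :=
  mul_pos (Nat.cast_pos.2 (by omega)) (inv_pos.2 (ratioSum_pos hd hα))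

variable [NeZero d]

lemma omega_pow_mul_sub_eq_conj_phase (k j : Fin d) :
    omega d ^ ((k : ℕ) * (d - (j : ℕ))) = conj (phase k j) := by
  have hprod : omega d ^ ((k : ℕ) * (d - (j : ℕ))) * phase k j = 1 := by
    rw [phase_apply, ← pow_add, ← mul_add, Nat.sub_add_cancel j.2.le, pow_mul',
      isPrimitiveRoot_omega.pow_eq_one, one_pow]
  calc _ = omega d ^ ((k : ℕ) * (d - (j : ℕ))) * phase k j * conj (phase k j) := by
        rw [mul_assoc, phase_mul_conj, mul_one]
    _ = conj (phase k j) := by rw [hprod, one_mul]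

lemma deltaCoeff_eq (α : Fin d → ℝ) (k : Fin d) :
    deltaCoeff α k
      = -((gammaCoeff α / d : ℝ) : ℂ) * ∑ j, (rowRatio α j : ℂ) * conj (phase k j) := by
  rw [deltaCoeff, Finset.sum_comm]
  congr 1
  refine Finset.sum_congr rfl fun j _ => ?_
  rw [rowRatio, Complex.ofReal_sum, Finset.sum_mul, omega_pow_mul_sub_eq_conj_phase]
  refine Finset.sum_congr rfl fun i _ => ?_
  split_ifs <;> simp

lemma deltaCoeff_zero {α : Fin d → ℝ} (hα : ratioSum α ≠ 0) : deltaCoeff α 0 = -1 := by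
  have hd : (d : ℝ) ≠ 0 := Nat.cast_ne_zero.2 (NeZero.ne d)
  have hγ : gammaCoeff α / d * ratioSum α = 1 := by
    rw [gammaCoeff]
    field_simp
  have h := deltaCoeff_eq α 0
  simp only [phase_zero_left, map_one, mul_one, ← Complex.ofReal_sum, sum_rowRatio, neg_mul,
    ← Complex.ofReal_mul, hγ, Complex.ofReal_one] at h
  exact h

end SteeringCoefficients

section Correlators

variable {d : ℕ} {K : Type*} [NormedAddCommGroup K] [InnerProductSpace ℂ K]

lemma genObs_zero {M : Fin d → K →ₗ[ℂ] K} (hM : IsPOVM M) : genObs M 0 = 1 := by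
  simp [genObs, hM.2]

lemma map_genObs {L : Type*} [NormedAddCommGroup L] [InnerProductSpace ℂ L]
    (M : Fin d → K →ₗ[ℂ] K) (k : ℕ) :
    TensorProduct.map (genObs M k) (1 : L →ₗ[ℂ] L)
      = genObs (fun b => TensorProduct.map (M b) 1) k := by
  simp only [genObs, ← TensorProduct.mapBilinear_apply, map_sum, map_smul, LinearMap.sum_apply,
    LinearMap.smul_apply]

variable [NeZero d]

lemma genObs_val (M : Fin d → K →ₗ[ℂ] K) (k : Fin d) : genObs M k = ∑ b, phase k b • M b := rfl

lemma expect_map_Z_pow (ψ : Qudit d ⊗[ℂ] K) (k : Fin d) (T : K →ₗ[ℂ] K) :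
    expect ψ (TensorProduct.map (Z d ^ (k : ℕ)) T)
      = ∑ i, phase k i * ⟪component i ψ, T (component i ψ)⟫_ℂ := by
  simp [expect_map, Z_pow_ket, inner_ket_ket]

lemma expect_map_X_pow (ψ : Qudit d ⊗[ℂ] K) (k : Fin d) (T : K →ₗ[ℂ] K) :
    expect ψ (TensorProduct.map (X d ^ (k : ℕ)) T)
      = ∑ j, ⟪component (j + k) ψ, T (component j ψ)⟫_ℂ := by
  rw [expect_map, Finset.sum_comm]
  simp [X_pow_ket, inner_ket_ket]

lemma sum_expect_Z_pow_genObs (ψ : Qudit d ⊗[ℂ] K) (A : Fin d → K →ₗ[ℂ] K) :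
    ∑ k : Fin d, expect ψ (TensorProduct.map (Z d ^ (k : ℕ)) (genObs A k))
      = d * ∑ i, ⟪component i ψ, A (-i) (component i ψ)⟫_ℂ := by
  have hterm : ∀ k i : Fin d, phase k i * ⟪component i ψ, genObs A k (component i ψ)⟫_ℂ
      = ∑ b, phase k i * conj (phase k b) * ⟪component i ψ, A (-b) (component i ψ)⟫_ℂ :=
    fun k i => by
      rw [genObs_val, ← Equiv.sum_comp (Equiv.neg (Fin d))]
      simp only [Equiv.neg_apply, phase_neg, LinearMap.sum_apply, LinearMap.smul_apply, inner_sum,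
        inner_smul_right, Finset.mul_sum, mul_assoc]
  simp only [expect_map_Z_pow, hterm]
  rw [Finset.sum_comm, Finset.mul_sum]
  refine Finset.sum_congr rfl fun i _ => ?_
  rw [Finset.sum_comm]
  simp only [← Finset.sum_mul, sum_phase_mul_conj, ite_mul, zero_mul, Finset.sum_ite_eq,
    Finset.mem_univ, if_true]

/-- The discrete Fourier transform `b ↦ ∑ j, ω^(-b j) v_j` of a family of vectors. -/
def fourier (v : Fin d → K) (b : Fin d) : K := ∑ j, conj (phase b j) • v j

lemma sum_expect_X_pow_genObs (ψ : Qudit d ⊗[ℂ] K) (C : Fin d → K →ₗ[ℂ] K) :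
    ∑ k : Fin d, expect ψ (TensorProduct.map (X d ^ (k : ℕ)) (genObs C k))
      = ∑ b, ⟪fourier (component · ψ) b, C b (fourier (component · ψ) b)⟫_ℂ := by
  have hform : ∀ b, ⟪fourier (component · ψ) b, C b (fourier (component · ψ) b)⟫_ℂ
      = ∑ j, ∑ k, phase k b * ⟪component (j + k) ψ, C b (component j ψ)⟫_ℂ := fun b => by
    simp only [fourier, map_sum, map_smul, inner_sum, sum_inner, inner_smul_left,
      inner_smul_right, Complex.conj_conj]
    refine Finset.sum_congr rfl fun j _ => ?_
    rw [← Equiv.sum_comp (Equiv.addLeft j), Finset.mul_sum]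
    refine Finset.sum_congr rfl fun k _ => ?_
    rw [Equiv.coe_addLeft, AddChar.map_add_eq_mul, phase_comm k]
    linear_combination phase b k * ⟪component (j + k) ψ, C b (component j ψ)⟫_ℂ *
      conj_mul_phase b j
  simp only [expect_map_X_pow, hform, genObs_val, LinearMap.sum_apply, LinearMap.smul_apply,
    inner_sum, inner_smul_right]
  calc _ = ∑ k, ∑ b, ∑ j, phase k b * ⟪component (j + k) ψ, C b (component j ψ)⟫_ℂ :=
        Finset.sum_congr rfl fun _ _ => Finset.sum_comm
    _ = ∑ b, ∑ k, ∑ j, phase k b * ⟪component (j + k) ψ, C b (component j ψ)⟫_ℂ :=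
        Finset.sum_comm
    _ = _ := Finset.sum_congr rfl fun _ _ => Finset.sum_comm

lemma sum_deltaCoeff_mul_expect_Z_pow (α : Fin d → ℝ) (ψ : Qudit d ⊗[ℂ] K) :
    ∑ k : Fin d, deltaCoeff α k * expect ψ (TensorProduct.map (Z d ^ (k : ℕ)) 1)
      = -(gammaCoeff α : ℂ) * ∑ l, rowRatio α l * ⟪component l ψ, component l ψ⟫_ℂ := by
  have hd : (d : ℂ) ≠ 0 := Nat.cast_ne_zero.2 (NeZero.ne d)
  have hterm : ∀ k : Fin d, deltaCoeff α k * expect ψ (TensorProduct.map (Z d ^ (k : ℕ)) 1)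
      = ∑ l, ∑ j, -((gammaCoeff α / d : ℝ) : ℂ) * rowRatio α j
        * ⟪component l ψ, component l ψ⟫_ℂ * (phase k l * conj (phase k j)) := fun k => by
    rw [deltaCoeff_eq, expect_map_Z_pow, mul_assoc, Finset.sum_mul_sum, Finset.mul_sum,
      Finset.sum_comm]
    simp only [Finset.mul_sum, Module.End.one_apply]
    exact Finset.sum_congr rfl fun l _ => Finset.sum_congr rfl fun j _ => by ring
  simp only [hterm]
  rw [Finset.sum_comm, Finset.mul_sum]
  refine Finset.sum_congr rfl fun l _ => ?_
  rw [Finset.sum_comm]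
  simp only [← Finset.mul_sum, sum_phase_mul_conj, mul_ite, mul_zero, Finset.sum_ite_eq,
    Finset.mem_univ, if_true]
  push_cast
  field_simp

end Correlators

section SumOfSquares

variable {K : Type*} [NormedAddCommGroup K] [InnerProductSpace ℂ K]

lemma sum_mul_inner_sub_apply_sub {ι : Type*} [Fintype ι] (w : ι → ℝ) (x : ι → K)
    (T : K →ₗ[ℂ] K) {m : K} (hm : ((∑ i, w i : ℝ) : ℂ) • m = ∑ i, (w i : ℂ) • x i) :
    ∑ i, (w i : ℂ) * ⟪x i - m, T (x i - m)⟫_ℂ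
      = ∑ i, (w i : ℂ) * ⟪x i, T (x i)⟫_ℂ - ((∑ i, w i : ℝ) : ℂ) * ⟪m, T m⟫_ℂ := by
  have hleft : ∑ i, (w i : ℂ) * ⟪x i, T m⟫_ℂ = ((∑ i, w i : ℝ) : ℂ) * ⟪m, T m⟫_ℂ := by
    have h := congrArg (fun y => ⟪y, T m⟫_ℂ) hm
    simpa only [sum_inner, inner_smul_left, Complex.conj_ofReal] using h.symm
  have hright : ∑ i, (w i : ℂ) * ⟪m, T (x i)⟫_ℂ = ((∑ i, w i : ℝ) : ℂ) * ⟪m, T m⟫_ℂ := by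
    have h := congrArg (fun y => ⟪m, T y⟫_ℂ) hm
    simpa only [map_sum, map_smul, inner_sum, inner_smul_right] using h.symm
  simp only [map_sub, inner_sub_left, inner_sub_right, mul_sub, Finset.sum_sub_distrib, hleft,
    hright, ← Finset.sum_mul, ← Complex.ofReal_sum]
  ring

lemma sum_mul_re_inner_eq_zero_iff [FiniteDimensional ℂ K] {ι : Type*} [Fintype ι] {w : ι → ℝ}
    (hw : ∀ i, 0 < w i) {T : ι → K →ₗ[ℂ] K} (hT : ∀ i, (T i).IsPositive) (x : ι → K) :
    ∑ i, w i * (⟪x i, T i (x i)⟫_ℂ).re = 0 ↔ ∀ i, T i (x i) = 0 := by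
  have hnonneg : ∀ i ∈ Finset.univ, 0 ≤ w i * (⟪x i, T i (x i)⟫_ℂ).re := fun i _ =>
    mul_nonneg (hw i).le ((hT i).re_inner_nonneg_right _)
  rw [Finset.sum_eq_zero_iff_of_nonneg hnonneg]
  refine ⟨fun h i => ?_, fun h i _ => by simp [h i]⟩
  exact apply_eq_zero_of_re_inner_eq_zero (hT i)
    ((mul_eq_zero.1 (h i (Finset.mem_univ i))).resolve_left (hw i).ne')

variable {d : ℕ} {α : Fin d → ℝ}

/-- The amount by which Bob's first measurement fails to be perfectly correlated with Alice's
computational basis. -/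
def computationalDefect (α : Fin d → ℝ) (ξ : Fin d → K) (A : Fin d → K →ₗ[ℂ] K) : ℝ :=
  ∑ i, α i ^ 2 * (⟪ξ i, (1 - A (-i)) (ξ i)⟫_ℂ).re

lemma computationalDefect_nonneg {ξ : Fin d → K} {A : Fin d → K →ₗ[ℂ] K} (hA : IsPOVM A) :
    0 ≤ computationalDefect α ξ A :=
  Finset.sum_nonneg fun i _ => mul_nonneg (sq_nonneg _)
    ((hA.isPositive_one_sub (-i)).re_inner_nonneg_right _)

lemma computationalDefect_eq_zero_iff [FiniteDimensional ℂ K] (hα : ∀ i, 0 < α i)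
    {ξ : Fin d → K} {A : Fin d → K →ₗ[ℂ] K} (hA : IsPOVM A) :
    computationalDefect α ξ A = 0 ↔ ∀ i, A (-i) (ξ i) = ξ i := by
  rw [computationalDefect, sum_mul_re_inner_eq_zero_iff (fun i => pow_pos (hα i) 2)
    (fun i => hA.isPositive_one_sub (-i))]
  exact forall_congr' fun i => by
    rw [LinearMap.sub_apply, Module.End.one_apply, sub_eq_zero, eq_comm]

variable [NeZero d]

/-- The deviation of `ω^(-b j) ξ_j` from the weighted mean over `j`, with weights `α_j`. -/
def phaseDeviation (α : Fin d → ℝ) (ξ : Fin d → K) (b j : Fin d) : K :=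
  conj (phase b j) • ξ j - ((∑ i, α i : ℝ) : ℂ)⁻¹ • fourier (fun i => (α i : ℂ) • ξ i) b

/-- The amount by which Bob's second measurement fails to be perfectly correlated with Alice's
Fourier basis. -/
def fourierDefect (α : Fin d → ℝ) (ξ : Fin d → K) (C : Fin d → K →ₗ[ℂ] K) : ℝ :=
  ∑ p : Fin d × Fin d, α p.2 *
    (⟪phaseDeviation α ξ p.1 p.2, C p.1 (phaseDeviation α ξ p.1 p.2)⟫_ℂ).re

lemma fourierDefect_nonneg (hα : ∀ i, 0 < α i) {ξ : Fin d → K} {C : Fin d → K →ₗ[ℂ] K}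
    (hC : IsPOVM C) : 0 ≤ fourierDefect α ξ C :=
  Finset.sum_nonneg fun p _ => mul_nonneg (hα p.2).le ((hC.1 p.1).re_inner_nonneg_right _)

lemma apply_fourier_smul {ξ : Fin d → K} {T : K →ₗ[ℂ] K} {b : Fin d} {y : K}
    (h : ∀ j, T (ξ j) = phase b j • y) :
    T (fourier (fun i => (α i : ℂ) • ξ i) b) = ((∑ i, α i : ℝ) : ℂ) • y := by
  simp only [fourier, map_sum, map_smul, h, Complex.ofReal_sum, Finset.sum_smul]
  refine Finset.sum_congr rfl fun j _ => ?_
  rw [smul_smul, smul_smul, mul_right_comm, conj_mul_phase, one_mul]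

lemma fourierDefect_eq_zero_iff [FiniteDimensional ℂ K] (hα : ∀ i, 0 < α i)
    {ξ : Fin d → K} {C : Fin d → K →ₗ[ℂ] K} (hC : IsPOVM C) :
    fourierDefect α ξ C = 0 ↔ ∀ b j, C b (ξ j) = phase b j • C b (ξ 0) := by
  have hsum : ((∑ i, α i : ℝ) : ℂ) ≠ 0 :=
    Complex.ofReal_ne_zero.2 (Finset.sum_pos (fun i _ => hα i) Finset.univ_nonempty).ne'
  refine (sum_mul_re_inner_eq_zero_iff (w := fun p : Fin d × Fin d => α p.2)
    (T := fun p => C p.1) (fun p => hα p.2) (fun p => hC.1 p.1) _).trans ?_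
  rw [Prod.forall]
  refine forall_congr' fun b => ⟨fun h => ?_, fun h j => ?_⟩
  · have hmean : ∀ j, C b (ξ j) = phase b j • C b
        (((∑ i, α i : ℝ) : ℂ)⁻¹ • fourier (fun i => (α i : ℂ) • ξ i) b) := fun j => by
      have hj := h j
      rw [phaseDeviation, map_sub, map_smul, sub_eq_zero] at hj
      rw [← hj, smul_smul, phase_mul_conj, one_smul]
    intro j
    rw [hmean j, hmean 0, AddChar.map_zero_eq_one, one_smul]
  · rw [phaseDeviation, map_sub, map_smul, map_smul, apply_fourier_smul h, h j, smul_smul,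
      conj_mul_phase, one_smul, inv_smul_smul₀ hsum, sub_self]

lemma sum_inner_fourier (hα : ∀ i, 0 < α i) (ξ : Fin d → K) {C : Fin d → K →ₗ[ℂ] K}
    (hC : IsPOVM C) :
    ∑ b, ⟪fourier (fun i => (α i : ℂ) • ξ i) b, C b (fourier (fun i => (α i : ℂ) • ξ i) b)⟫_ℂ
      = ((∑ i, α i : ℝ) : ℂ) * (∑ j, (α j : ℂ) * ⟪ξ j, ξ j⟫_ℂ - ∑ p : Fin d × Fin d,
        (α p.2 : ℂ) * ⟪phaseDeviation α ξ p.1 p.2, C p.1 (phaseDeviation α ξ p.1 p.2)⟫_ℂ) := by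
  set s : ℂ := ((∑ i, α i : ℝ) : ℂ) with hs
  have hs0 : s ≠ 0 :=
    Complex.ofReal_ne_zero.2 (Finset.sum_pos (fun i _ => hα i) Finset.univ_nonempty).ne'
  have hconj : conj s = s := Complex.conj_ofReal _
  have hdev : ∀ b, ∑ j, (α j : ℂ) * ⟪phaseDeviation α ξ b j, C b (phaseDeviation α ξ b j)⟫_ℂ
      = ∑ j, (α j : ℂ) * ⟪ξ j, C b (ξ j)⟫_ℂ - s⁻¹ *
        ⟪fourier (fun i => (α i : ℂ) • ξ i) b, C b (fourier (fun i => (α i : ℂ) • ξ i) b)⟫_ℂ :=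
    fun b => by
      have hphase : ∀ j, ⟪conj (phase b j) • ξ j, C b (conj (phase b j) • ξ j)⟫_ℂ
          = ⟪ξ j, C b (ξ j)⟫_ℂ := fun j => by
        rw [map_smul, inner_smul_left, inner_smul_right, Complex.conj_conj, ← mul_assoc,
          phase_mul_conj, one_mul]
      have h := sum_mul_inner_sub_apply_sub α (fun j => conj (phase b j) • ξ j) (C b)
        (m := s⁻¹ • fourier (fun i => (α i : ℂ) • ξ i) b) (by
          rw [← hs, smul_inv_smul₀ hs0, fourier]
          exact Finset.sum_congr rfl fun j _ => smul_comm _ _ _)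
      simp only [hphase] at h
      simp only [phaseDeviation, ← hs, h, map_smul, inner_smul_left, inner_smul_right, map_inv₀,
        hconj]
      field_simp
  rw [Fintype.sum_prod_type]
  simp only [hdev, Finset.sum_sub_distrib, ← Finset.mul_sum]
  rw [Finset.sum_comm]
  simp only [← Finset.mul_sum, hC.sum_inner_apply]
  field_simp
  ring

end SumOfSquares

section SteeringFunctional

variable {d : ℕ} {K : Type*} [NormedAddCommGroup K] [InnerProductSpace ℂ K] {α : Fin d → ℝ}

lemma inner_component_eq {i : Fin d} (hα : α i ≠ 0) (ψ : Qudit d ⊗[ℂ] K) (T : K →ₗ[ℂ] K) :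
    ⟪component i ψ, T (component i ψ)⟫_ℂ
      = (α i : ℂ) ^ 2 * ⟪relativeComponent α ψ i, T (relativeComponent α ψ i)⟫_ℂ := by
  rw [← smul_relativeComponent hα, map_smul, inner_smul_left, inner_smul_right,
    Complex.conj_ofReal]
  ring

lemma re_sum_inner_component_eq (hα : ∀ i, α i ≠ 0) {ψ : Qudit d ⊗[ℂ] K} (hψ : ‖ψ‖ = 1)
    (A : Fin d → K →ₗ[ℂ] K) :
    (∑ i, ⟪component i ψ, A (-i) (component i ψ)⟫_ℂ).re
      = 1 - computationalDefect α (relativeComponent α ψ) A := by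
  have hnorm : ∑ i, ⟪component i ψ, component i ψ⟫_ℂ = 1 := by
    rw [sum_inner_component_self, inner_self_eq_one_of_norm_eq_one hψ]
  have hdefect : computationalDefect α (relativeComponent α ψ) A
      = (∑ i, ⟪component i ψ, (1 - A (-i)) (component i ψ)⟫_ℂ).re := by
    simp only [computationalDefect, inner_component_eq (hα _), Complex.re_sum,
      ← Complex.ofReal_pow, Complex.re_ofReal_mul]
  simp only [hdefect, LinearMap.sub_apply, Module.End.one_apply, inner_sub_right,
    Finset.sum_sub_distrib, hnorm, Complex.sub_re, Complex.one_re, sub_sub_cancel]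

lemma re_sum_rowRatio_mul_inner_component (hα : ∀ i, 0 < α i) {ψ : Qudit d ⊗[ℂ] K}
    (hψ : ‖ψ‖ = 1) :
    (∑ i, rowRatio α i * ⟪component i ψ, component i ψ⟫_ℂ).re
      = (∑ i, α i) * ∑ i, α i * (⟪relativeComponent α ψ i, relativeComponent α ψ i⟫_ℂ).re - 1 := by
  have hterm : ∀ i, (rowRatio α i * ⟪component i ψ, component i ψ⟫_ℂ).re
      = (∑ i, α i) * (α i * (⟪relativeComponent α ψ i, relativeComponent α ψ i⟫_ℂ).re)
        - (⟪component i ψ, component i ψ⟫_ℂ).re := fun i => by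
    have hinner : (⟪component i ψ, component i ψ⟫_ℂ).re
        = α i ^ 2 * (⟪relativeComponent α ψ i, relativeComponent α ψ i⟫_ℂ).re := by
      have h := congrArg Complex.re (inner_component_eq (hα i).ne' ψ 1)
      rwa [← Complex.ofReal_pow, Complex.re_ofReal_mul] at h
    rw [Complex.re_ofReal_mul, eq_sub_of_add_eq (rowRatio_add_one (hα i).ne'), hinner]
    field_simp [(hα i).ne']
  have hnorm : ∑ i, (⟪component i ψ, component i ψ⟫_ℂ).re = 1 := by
    rw [← Complex.re_sum, sum_inner_component_self, inner_self_eq_one_of_norm_eq_one hψ,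
      Complex.one_re]
  rw [Complex.re_sum]
  simp only [hterm, Finset.sum_sub_distrib, hnorm, Finset.mul_sum]

variable [NeZero d]

lemma re_sum_inner_fourier_component (hα : ∀ i, 0 < α i) (ψ : Qudit d ⊗[ℂ] K)
    {C : Fin d → K →ₗ[ℂ] K} (hC : IsPOVM C) :
    (∑ b, ⟪fourier (component · ψ) b, C b (fourier (component · ψ) b)⟫_ℂ).re
      = (∑ i, α i) * (∑ i, α i * (⟪relativeComponent α ψ i, relativeComponent α ψ i⟫_ℂ).re
        - fourierDefect α (relativeComponent α ψ) C) := by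
  have hcomponent : (component · ψ) = fun i => (α i : ℂ) • relativeComponent α ψ i :=
    funext fun i => (smul_relativeComponent (hα i).ne' ψ).symm
  rw [hcomponent, sum_inner_fourier hα _ hC]
  simp only [Complex.re_ofReal_mul, Complex.sub_re, Complex.re_sum, fourierDefect]

theorem steeringFunctional_eq (hd : 2 ≤ d) (hα : ∀ i, 0 < α i) {ψ : Qudit d ⊗[ℂ] K}
    (hψ : ‖ψ‖ = 1) {A C : Fin d → K →ₗ[ℂ] K} (hA : IsPOVM A) (hC : IsPOVM C) :
    (∑ k ∈ Finset.Ico 1 d,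
      (expect ψ (TensorProduct.map (Z d ^ k) (genObs A k))
        + (gammaCoeff α : ℂ) * expect ψ (TensorProduct.map (X d ^ k) (genObs C k))
        + deltaCoeff α k * expect ψ (TensorProduct.map (Z d ^ k) 1))).re
      = d - d * computationalDefect α (relativeComponent α ψ) A
        - gammaCoeff α * (∑ i, α i) * fourierDefect α (relativeComponent α ψ) C := by
  set term : ℕ → ℂ := fun k => expect ψ (TensorProduct.map (Z d ^ k) (genObs A k))
    + (gammaCoeff α : ℂ) * expect ψ (TensorProduct.map (X d ^ k) (genObs C k))
    + deltaCoeff α k * expect ψ (TensorProduct.map (Z d ^ k) 1) with hterm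
  have hzero : term 0 = gammaCoeff α := by
    have hψ' : expect ψ 1 = 1 := inner_self_eq_one_of_norm_eq_one hψ
    simp only [hterm, pow_zero, genObs_zero hA, genObs_zero hC, TensorProduct.map_one, hψ',
      deltaCoeff_zero (ratioSum_pos hd hα).ne']
    ring
  have hsplit : ∑ k : Fin d, term k = gammaCoeff α + ∑ k ∈ Finset.Ico 1 d, term k := by
    rw [Fin.sum_univ_eq_sum_range, Finset.range_eq_Ico,
      Finset.sum_eq_sum_Ico_succ_bot (by omega), hzero]
  have hsum : ∑ k : Fin d, term k
      = (d : ℝ) * ∑ i, ⟪component i ψ, A (-i) (component i ψ)⟫_ℂ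
        + (gammaCoeff α : ℂ) * ∑ b, ⟪fourier (component · ψ) b, C b (fourier (component · ψ) b)⟫_ℂ
        + ((-gammaCoeff α : ℝ) : ℂ) * ∑ i, rowRatio α i * ⟪component i ψ, component i ψ⟫_ℂ := by
    simp only [hterm, Finset.sum_add_distrib, ← Finset.mul_sum, sum_expect_Z_pow_genObs,
      sum_expect_X_pow_genObs, sum_deltaCoeff_mul_expect_Z_pow, Complex.ofReal_neg,
      Complex.ofReal_natCast]
  have hre := congrArg Complex.re (hsplit.symm.trans hsum)
  rw [Complex.add_re, Complex.add_re, Complex.add_re, Complex.re_ofReal_mul,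
    Complex.re_ofReal_mul, Complex.re_ofReal_mul, Complex.ofReal_re,
    re_sum_inner_component_eq (fun i => (hα i).ne') hψ,
    re_sum_inner_fourier_component hα ψ hC, re_sum_rowRatio_mul_inner_component hα hψ] at hre
  linear_combination hre

/-- The state `∑ i, α_i |i⟩ ⊗ ξ_i` is perfectly correlated with Alice's computational basis by the
measurement `A` and with her Fourier basis by the measurement `C`; this does not depend on `α`. -/
def IsPerfectlyCorrelated (ξ : Fin d → K) (A C : Fin d → K →ₗ[ℂ] K) : Prop :=
  (∀ i, A (-i) (ξ i) = ξ i) ∧ ∀ b j, C b (ξ j) = phase b j • C b (ξ 0)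

end SteeringFunctional

section MaximalViolation

variable {d : ℕ} {HB HE : Type*} [NormedAddCommGroup HB] [InnerProductSpace ℂ HB]
  [FiniteDimensional ℂ HB] [NormedAddCommGroup HE] [InnerProductSpace ℂ HE]
  [FiniteDimensional ℂ HE] [NeZero d] {α : Fin d → ℝ}

lemma Realization.value_eq (hd : 2 ≤ d) (hα : ∀ i, 0 < α i) (r : Realization d HB HE) :
    r.value α = d
      - d * computationalDefect α (relativeComponent α r.ψ) (fun b => TensorProduct.map (r.B₀ b) 1)
      - gammaCoeff α * (∑ i, α i)
        * fourierDefect α (relativeComponent α r.ψ) (fun b => TensorProduct.map (r.B₁ b) 1) := by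
  simp only [← steeringFunctional_eq hd hα r.norm_ψ r.povm_B₀.map_one r.povm_B₁.map_one,
    Realization.value, tri, map_genObs, TensorProduct.map_one]

lemma Realization.value_le (hd : 2 ≤ d) (hα : ∀ i, 0 < α i) (r : Realization d HB HE) :
    r.value α ≤ d := by
  have hZ := mul_nonneg d.cast_nonneg
    (computationalDefect_nonneg (α := α) (ξ := relativeComponent α r.ψ)
      (r.povm_B₀.map_one (K := HE)))
  have hX := mul_nonneg
    (mul_nonneg (gammaCoeff_pos hd hα).le (Finset.univ.sum_nonneg fun i _ => (hα i).le))
    (fourierDefect_nonneg hα (ξ := relativeComponent α r.ψ) (r.povm_B₁.map_one (K := HE)))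
  rw [r.value_eq hd hα]
  linarith

lemma Realization.value_eq_iff (hd : 2 ≤ d) (hα : ∀ i, 0 < α i) (r : Realization d HB HE) :
    r.value α = d ↔ IsPerfectlyCorrelated (relativeComponent α r.ψ)
      (fun b => TensorProduct.map (r.B₀ b) 1) (fun b => TensorProduct.map (r.B₁ b) 1) := by
  have hd0 : (0 : ℝ) < d := Nat.cast_pos.2 (by omega)
  have hγ : 0 < gammaCoeff α * ∑ i, α i :=
    mul_pos (gammaCoeff_pos hd hα) (Finset.sum_pos (fun i _ => hα i) Finset.univ_nonempty)
  have hZ := r.povm_B₀.map_one (K := HE)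
  have hX := r.povm_B₁.map_one (K := HE)
  rw [IsPerfectlyCorrelated, ← computationalDefect_eq_zero_iff hα hZ,
    ← fourierDefect_eq_zero_iff hα hX, r.value_eq hd hα, sub_sub, sub_eq_self,
    add_eq_zero_iff_of_nonneg (mul_nonneg hd0.le (computationalDefect_nonneg hZ))
      (mul_nonneg hγ.le (fourierDefect_nonneg hα hX)),
    mul_eq_zero_iff_left hd0.ne', mul_eq_zero_iff_left hγ.ne']

end MaximalViolation

section IdealRealization

variable {d : ℕ} {α : Fin d → ℝ}

/-- The state `|ψ(α)⟩` as a state of Alice, Bob and a trivial system of the eavesdropper. -/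
def idealTripartite (α : Fin d → ℝ) : Qudit d ⊗[ℂ] (Qudit d ⊗[ℂ] ℂ) :=
  ∑ i, (α i : ℂ) • (ket i ⊗ₜ[ℂ] (ket i ⊗ₜ[ℂ] (1 : ℂ)))

lemma component_idealTripartite (α : Fin d → ℝ) (i : Fin d) :
    component i (idealTripartite α) = (α i : ℂ) • (ket i ⊗ₜ[ℂ] (1 : ℂ)) := by
  simp only [idealTripartite, map_sum, map_smul, component_tmul, ket_apply, ite_smul, one_smul,
    zero_smul, smul_ite, smul_zero, Finset.sum_ite_eq, Finset.mem_univ, if_true]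

lemma norm_idealTripartite (hα : ∑ i, α i ^ 2 = 1) : ‖idealTripartite α‖ = 1 := by
  have hinner : ⟪idealTripartite α, idealTripartite α⟫_ℂ = ((∑ i, α i ^ 2 : ℝ) : ℂ) := by
    rw [← sum_inner_component_self]
    simp only [component_idealTripartite, TensorProduct.smul_tmul', TensorProduct.inner_tmul,
      inner_smul_left, inner_smul_right, inner_ket_ket, if_true, RCLike.inner_apply, map_one,
      Complex.conj_ofReal, mul_one]
    push_cast
    exact Finset.sum_congr rfl fun i _ => (sq _).symm
  have hnorm : ‖idealTripartite α‖ ^ 2 = 1 := by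
    refine Complex.ofReal_injective ?_
    rw [Complex.ofReal_pow, ← hα, ← hinner]
    exact (inner_self_eq_norm_sq_to_K (𝕜 := ℂ) (idealTripartite α)).symm
  exact (pow_eq_one_iff_of_nonneg (norm_nonneg _) two_ne_zero).1 hnorm

lemma relativeComponent_idealTripartite {i : Fin d} (hα : α i ≠ 0) :
    relativeComponent α (idealTripartite α) i = ket i ⊗ₜ[ℂ] (1 : ℂ) := by
  rw [relativeComponent, component_idealTripartite, inv_smul_smul₀ (Complex.ofReal_ne_zero.2 hα)]

lemma expect_idealTripartite (α : Fin d → ℝ) (S T : Qudit d →ₗ[ℂ] Qudit d)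
    (V : ℂ →ₗ[ℂ] ℂ) :
    expect (idealTripartite α) (tri S T V)
      = V 1 * expect (idealState α) (TensorProduct.map S T) := by
  simp only [tri, expect_map, Finset.mul_sum, component_idealTripartite, component_idealState,
    TensorProduct.smul_tmul', TensorProduct.map_tmul, TensorProduct.inner_tmul, map_smul,
    inner_smul_left, inner_smul_right, RCLike.inner_apply, map_one, mul_one]
  exact Finset.sum_congr rfl fun i _ => Finset.sum_congr rfl fun j _ => by ring

lemma isPOVM_ketbra_ket_neg : IsPOVM fun b : Fin d => ketbra (ket (-b)) (ket (-b)) := by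
  refine ⟨fun b => isPositive_ketbra _, ?_⟩
  calc _ = ∑ b : Fin d, ketbra (ket b) (ket b) :=
        Equiv.sum_comp (Equiv.neg (Fin d)) fun b : Fin d => ketbra (ket b) (ket b)
    _ = 1 := linearMap_ext_ket fun i => by simp [ketbra_apply, inner_ket_ket]

variable [NeZero d]

lemma inner_fourier_ket_ket (b j : Fin d) : ⟪fourier ket b, ket j⟫_ℂ = phase b j := by
  simp [fourier, inner_ket_ket]

lemma inner_ket_fourier_ket (b j : Fin d) : ⟪ket j, fourier ket b⟫_ℂ = conj (phase b j) := by
  rw [← inner_conj_symm, inner_fourier_ket_ket]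

open scoped ComplexOrder in
lemma isPOVM_ketbra_fourier_ket :
    IsPOVM fun b : Fin d => (d : ℂ)⁻¹ • ketbra (fourier ket b) (fourier ket b) := by
  have hd : (d : ℂ) ≠ 0 := Nat.cast_ne_zero.2 (NeZero.ne d)
  refine ⟨fun b => (isPositive_ketbra _).smul_of_nonneg (by positivity),
    linearMap_ext_inner_ket fun i j => ?_⟩
  simp only [LinearMap.sum_apply, LinearMap.smul_apply, ketbra_apply, inner_sum, inner_smul_right,
    inner_fourier_ket_ket, inner_ket_fourier_ket, ← Finset.mul_sum, sum_phase_mul_conj,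
    Module.End.one_apply, inner_ket_ket]
  rcases eq_or_ne i j with rfl | hij
  · simp [hd]
  · simp [hij, hij.symm]

/-- The ideal realisation: the state `|ψ(α)⟩`, measured by Bob in the computational and in the
Fourier basis. -/
def idealRealization (α : Fin d → ℝ) (hα : ∑ i, α i ^ 2 = 1) : Realization d (Qudit d) ℂ where
  ψ := idealTripartite α
  norm_ψ := norm_idealTripartite hα
  B₀ b := ketbra (ket (-b)) (ket (-b))
  B₁ b := (d : ℂ)⁻¹ • ketbra (fourier ket b) (fourier ket b)
  povm_B₀ := isPOVM_ketbra_ket_neg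
  povm_B₁ := isPOVM_ketbra_fourier_ket

lemma value_idealRealization (hd : 2 ≤ d) (hα : ∀ i, 0 < α i) (hα1 : ∑ i, α i ^ 2 = 1) :
    (idealRealization α hα1).value α = d := by
  rw [Realization.value_eq_iff hd hα]
  constructor
  · intro i
    simp [idealRealization, relativeComponent_idealTripartite (hα _).ne', ketbra_apply, norm_ket]
  · intro b j
    simp only [idealRealization, relativeComponent_idealTripartite (hα _).ne',
      TensorProduct.map_tmul, LinearMap.smul_apply, ketbra_apply, inner_fourier_ket_ket,
      AddChar.map_zero_eq_one, one_smul, TensorProduct.smul_tmul', smul_comm (d : ℂ)⁻¹]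

theorem isGreatest_quantumValues (hd : 2 ≤ d) (hα : ∀ i, 0 < α i) (hα1 : ∑ i, α i ^ 2 = 1) :
    IsGreatest (quantumValues α) d := by
  refine ⟨⟨Qudit d, ℂ, inferInstance, inferInstance, inferInstance, inferInstance, inferInstance,
    inferInstance, idealRealization α hα1, (value_idealRealization hd hα hα1).symm⟩, ?_⟩
  rintro _ ⟨HB, HE, _, _, _, _, _, _, r, rfl⟩
  exact r.value_le hd hα

lemma Realization.violatesMaximally_iff {HB HE : Type*}
    [NormedAddCommGroup HB] [InnerProductSpace ℂ HB] [NormedAddCommGroup HE]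
    [InnerProductSpace ℂ HE] (hd : 2 ≤ d) (hα : ∀ i, 0 < α i) (hα1 : ∑ i, α i ^ 2 = 1)
    (r : Realization d HB HE) : r.ViolatesMaximally α ↔ r.value α = d := by
  have hgreatest := isGreatest_quantumValues hd hα hα1
  exact ⟨fun h => h.unique hgreatest, fun h => by rwa [ViolatesMaximally, h]⟩

end IdealRealization

section Decoupling

variable {d : ℕ} [NeZero d] {K : Type*} [NormedAddCommGroup K] [InnerProductSpace ℂ K]
  {ξ : Fin d → K} {A C : Fin d → K →ₗ[ℂ] K} {G : K →ₗ[ℂ] K}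

lemma IsPerfectlyCorrelated.inner_map_eq_zero [FiniteDimensional ℂ K]
    (h : IsPerfectlyCorrelated ξ A C) (hA : IsPOVM A) (hG : ∀ b, Commute G (A b))
    {i j : Fin d} (hij : i ≠ j) : ⟪ξ i, G (ξ j)⟫_ℂ = 0 := by
  have hGA : G (A (-i) (ξ j)) = A (-i) (G (ξ j)) := LinearMap.congr_fun (hG (-i)) (ξ j)
  have hAj : A (-i) (ξ j) = 0 :=
    hA.apply_eq_zero_of_apply_eq_self (fun h => hij (neg_injective h)) (h.1 j)
  rw [← h.1 i, (hA.1 _).isSymmetric, ← hGA, hAj, map_zero, inner_zero_right]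

lemma IsPerfectlyCorrelated.inner_map_self_eq (h : IsPerfectlyCorrelated ξ A C) (hC : IsPOVM C)
    (hG : ∀ b, Commute G (C b)) (i : Fin d) : ⟪ξ i, G (ξ i)⟫_ℂ = ⟪ξ 0, G (ξ 0)⟫_ℂ := by
  have hGC : ∀ b x, G (C b x) = C b (G x) := fun b => LinearMap.congr_fun (hG b)
  have hexpand : ∀ j, ⟪ξ j, G (ξ j)⟫_ℂ = ∑ b, ⟪C b (ξ j), G (ξ j)⟫_ℂ := fun j => by
    rw [← sum_inner, hC.sum_apply]
  rw [hexpand i, hexpand 0]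
  refine Finset.sum_congr rfl fun b _ => ?_
  calc ⟪C b (ξ i), G (ξ i)⟫_ℂ = ⟪ξ i, G (C b (ξ i))⟫_ℂ := by rw [(hC.1 b).isSymmetric, hGC]
    _ = phase b i * ⟪C b (ξ i), G (ξ 0)⟫_ℂ := by
      rw [h.2 b i, map_smul, inner_smul_right, hGC, ← (hC.1 b).isSymmetric, h.2 b i]
    _ = ⟪C b (ξ 0), G (ξ 0)⟫_ℂ := by
      rw [h.2 b i, inner_smul_left, ← mul_assoc, phase_mul_conj, one_mul]

lemma IsPerfectlyCorrelated.compression_eq_smul_one [FiniteDimensional ℂ K]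
    (h : IsPerfectlyCorrelated ξ A C) (hA : IsPOVM A) (hC : IsPOVM C)
    (hGA : ∀ b, Commute G (A b)) (hGC : ∀ b, Commute G (C b)) :
    compression ξ G = ⟪ξ 0, G (ξ 0)⟫_ℂ • 1 := by
  refine linearMap_ext_inner_ket fun i j => ?_
  rw [inner_compression, LinearMap.smul_apply, inner_smul_right, Module.End.one_apply,
    inner_ket_ket]
  rcases eq_or_ne i j with rfl | hij
  · simp [h.inner_map_self_eq hC hGC]
  · simp [h.inner_map_eq_zero hA hGA hij, hij]

end Decoupling

section Extremal

variable {O H : Type*} [Fintype O] [NormedAddCommGroup H] [InnerProductSpace ℂ H]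

lemma IsExtremalPOVM.eq_smul {I N : O → H →ₗ[ℂ] H} (hI : IsExtremalPOVM I) {q : ℝ} (hq0 : 0 ≤ q)
    (hq1 : q ≤ 1) (hN : ∀ b, (N b).IsPositive) (hIN : ∀ b, (I b - N b).IsPositive)
    (hsum : ∑ b, N b = (q : ℂ) • 1) (b : O) : N b = (q : ℂ) • I b := by
  have hpos : ∀ {c : ℝ}, 0 ≤ c → ∀ b, ((c : ℂ) • I b).IsPositive := fun hc b =>
    (hI.1.1 b).smul_of_nonneg (Complex.zero_le_real.2 hc)
  -- `I` is the midpoint of the POVMs `I + (N - q • I)` and `I - (N - q • I)`.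
  have hadd : IsPOVM fun b => ((1 - q : ℝ) : ℂ) • I b + N b := by
    refine ⟨fun b => (hpos (sub_nonneg.2 hq1) b).add (hN b), ?_⟩
    rw [Finset.sum_add_distrib, ← Finset.smul_sum, hI.1.2, hsum, ← add_smul]
    simp
  have hsub : IsPOVM fun b => (I b - N b) + (q : ℂ) • I b := by
    refine ⟨fun b => (hIN b).add (hpos hq0 b), ?_⟩
    rw [Finset.sum_add_distrib, Finset.sum_sub_distrib, ← Finset.smul_sum, hI.1.2, hsum]
    simp
  have hmid : I ∈ openSegment ℝ (fun b => ((1 - q : ℝ) : ℂ) • I b + N b)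
      (fun b => (I b - N b) + (q : ℂ) • I b) := by
    refine ⟨1 / 2, 1 / 2, by norm_num, by norm_num, by norm_num, ?_⟩
    ext b x
    simp only [Pi.add_apply, Pi.smul_apply, LinearMap.add_apply, LinearMap.smul_apply,
      LinearMap.sub_apply, ← Complex.coe_smul]
    push_cast
    module
  have heq : ((1 - q : ℝ) : ℂ) • I b + N b = I b := congrFun (hI.2 hadd hsub hmid) b
  rw [Complex.ofReal_sub, Complex.ofReal_one, sub_smul, one_smul, sub_add_eq_add_sub,
    sub_eq_iff_eq_add] at heq
  exact add_left_cancel heq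

lemma IsExtremalPOVM.eq_smul_of_sum_eq {ι : Type*} [Fintype ι] {I : O → H →ₗ[ℂ] H}
    (hI : IsExtremalPOVM I) {q : ι → ℝ} (hq0 : ∀ c, 0 ≤ q c) (hq1 : ∑ c, q c = 1)
    {M : ι → O → H →ₗ[ℂ] H} (hM : ∀ c b, (M c b).IsPositive) (hMI : ∀ b, ∑ c, M c b = I b)
    (hMq : ∀ c, ∑ b, M c b = (q c : ℂ) • 1) (c : ι) (b : O) : M c b = (q c : ℂ) • I b := by
  classical
  have hqle : q c ≤ 1 := hq1 ▸ Finset.single_le_sum (fun c _ => hq0 c) (Finset.mem_univ c)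
  refine hI.eq_smul (hq0 c) hqle (hM c) (fun b => ?_) (hMq c) b
  rw [← hMI b, ← Finset.sum_erase_add _ _ (Finset.mem_univ c), add_sub_cancel_right]
  exact LinearMap.isPositive_sum _ fun c _ => hM c b

end Extremal

section Guessing

lemma commute_map_one_map_one {HB HE : Type*} [NormedAddCommGroup HB] [InnerProductSpace ℂ HB]
    [NormedAddCommGroup HE] [InnerProductSpace ℂ HE] (T : HB →ₗ[ℂ] HB) (V : HE →ₗ[ℂ] HE) :
    Commute (TensorProduct.map 1 V) (TensorProduct.map T 1) := by
  rw [Commute, SemiconjBy, ← TensorProduct.map_mul, ← TensorProduct.map_mul, one_mul, one_mul,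
    mul_one, mul_one]

variable {d : ℕ} {O HB HE : Type*} [Fintype O]
  [NormedAddCommGroup HB] [InnerProductSpace ℂ HB] [FiniteDimensional ℂ HB]
  [NormedAddCommGroup HE] [InnerProductSpace ℂ HE] [FiniteDimensional ℂ HE]
  {α : Fin d → ℝ} {I : O → Qudit d →ₗ[ℂ] Qudit d}

lemma Strategy.isPositive_compression_E (s : Strategy d O HB HE) (α : Fin d → ℝ) (c : O) :
    (compression (relativeComponent α s.ψ) (TensorProduct.map 1 (s.E c))).IsPositive :=
  isPositive_compression (isPositive_map LinearMap.isPositive_one (s.povm_E.1 c)) _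

variable [NeZero d]

lemma Realization.ViolatesMaximally.compression_map_one {r : Realization d HB HE}
    (hr : r.ViolatesMaximally α) (hd : 2 ≤ d) (hα : ∀ i, 0 < α i) (hα1 : ∑ i, α i ^ 2 = 1)
    (V : HE →ₗ[ℂ] HE) :
    compression (relativeComponent α r.ψ) (TensorProduct.map 1 V)
      = ⟪ket 0, compression (relativeComponent α r.ψ) (TensorProduct.map 1 V) (ket 0)⟫_ℂ • 1 := by
  rw [r.violatesMaximally_iff hd hα hα1, r.value_eq_iff hd hα] at hr
  rw [inner_compression]
  exact hr.compression_eq_smul_one r.povm_B₀.map_one r.povm_B₁.map_one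
    (fun _ => commute_map_one_map_one _ _) fun _ => commute_map_one_map_one _ _

lemma Strategy.MatchesPOVM.compression_R {s : Strategy d O HB HE} (hs : s.MatchesPOVM α I)
    (hα : ∀ i, α i ≠ 0) (b : O) :
    compression (relativeComponent α s.ψ) (TensorProduct.map (s.R b) 1) = I b :=
  eq_of_expect_U_idealState_eq hα fun k l => by
    rw [← expect_map_eq_compression hα]
    exact hs b k l

/-- The probability of Eve's outcome `c`, provided that Alice found her system in the state `|0⟩`:
under maximal violation Eve's outcome does not depend on the basis state found by Alice. -/
def Strategy.eveProbability (s : Strategy d O HB HE) (α : Fin d → ℝ) (c : O) : ℝ :=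
  (⟪ket 0, compression (relativeComponent α s.ψ) (TensorProduct.map 1 (s.E c)) (ket 0)⟫_ℂ).re

lemma Strategy.eveProbability_nonneg (s : Strategy d O HB HE) (α : Fin d → ℝ) (c : O) :
    0 ≤ s.eveProbability α c :=
  (s.isPositive_compression_E α c).re_inner_nonneg_right _

lemma Strategy.ofReal_eveProbability (s : Strategy d O HB HE) (α : Fin d → ℝ) (c : O) :
    (s.eveProbability α c : ℂ)
      = ⟪ket 0, compression (relativeComponent α s.ψ) (TensorProduct.map 1 (s.E c)) (ket 0)⟫_ℂ :=
  (s.isPositive_compression_E α c).isSymmetric.coe_re_inner_self_apply _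

lemma Strategy.sum_eveProbability {s : Strategy d O HB HE} (hs : s.MatchesPOVM α I)
    (hα : ∀ i, α i ≠ 0) (hI : IsPOVM I) : ∑ c, s.eveProbability α c = 1 := by
  have hcompression : compression (relativeComponent α s.ψ) 1 = 1 := by
    rw [← s.povm_R.map_one.2, compression_sum, ← hI.2]
    exact Finset.sum_congr rfl fun b _ => hs.compression_R hα b
  simp only [eveProbability]
  rw [← Complex.re_sum, ← inner_sum, ← LinearMap.sum_apply, ← compression_sum,
    s.povm_E.sum_map_right, TensorProduct.map_one, hcompression, Module.End.one_apply,
    inner_ket_ket, if_pos rfl, Complex.one_re]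

lemma Strategy.compression_map_R_E {s : Strategy d O HB HE} (hv : s.ViolatesMaximally α)
    (hm : s.MatchesPOVM α I) (hd : 2 ≤ d) (hα : ∀ i, 0 < α i) (hα1 : ∑ i, α i ^ 2 = 1)
    (hI : IsExtremalPOVM I) (c b : O) :
    compression (relativeComponent α s.ψ) (TensorProduct.map (s.R b) (s.E c))
      = (s.eveProbability α c : ℂ) • I b := by
  have hα0 : ∀ i, α i ≠ 0 := fun i => (hα i).ne'
  refine hI.eq_smul_of_sum_eq (s.eveProbability_nonneg α) (sum_eveProbability hm hα0 hI.1)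
    (M := fun c b => compression (relativeComponent α s.ψ) (TensorProduct.map (s.R b) (s.E c)))
    (fun c b => isPositive_compression (isPositive_map (s.povm_R.1 b) (s.povm_E.1 c)) _)
    (fun b => ?_) (fun c => ?_) c b
  · rw [← compression_sum, s.povm_E.sum_map_right, hm.compression_R hα0]
  · rw [← compression_sum, s.povm_R.sum_map_left, hv.compression_map_one hd hα hα1,
      s.ofReal_eveProbability]

/-- The probability `Tr[I_b ρ_B(α)]` of the outcome `b` of the POVM `I` in the target state. -/
def outcomeProbability (α : Fin d → ℝ) (I : O → Qudit d →ₗ[ℂ] Qudit d) (b : O) : ℝ :=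
  (LinearMap.trace ℂ (Qudit d) (I b ∘ₗ reducedState (idealState α))).re

lemma Strategy.guess_eq_sum {s : Strategy d O HB HE} (hv : s.ViolatesMaximally α)
    (hm : s.MatchesPOVM α I) (hd : 2 ≤ d) (hα : ∀ i, 0 < α i) (hα1 : ∑ i, α i ^ 2 = 1)
    (hI : IsExtremalPOVM I) :
    s.guess = ∑ b, s.eveProbability α b * outcomeProbability α I b := by
  rw [guess, Complex.re_sum]
  refine Finset.sum_congr rfl fun b _ => ?_
  rw [tri, expect_map_eq_compression fun i => (hα i).ne',
    compression_map_R_E hv hm hd hα hα1 hI, TensorProduct.map_smul_right, outcomeProbability,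
    trace_comp_reducedState, expect, LinearMap.smul_apply, inner_smul_right, Complex.re_ofReal_mul,
    expect]

lemma Strategy.guess_le {s : Strategy d O HB HE} (hv : s.ViolatesMaximally α)
    (hm : s.MatchesPOVM α I) (hd : 2 ≤ d) (hα : ∀ i, 0 < α i) (hα1 : ∑ i, α i ^ 2 = 1)
    (hI : IsExtremalPOVM I) : s.guess ≤ ⨆ b, outcomeProbability α I b := by
  rw [guess_eq_sum hv hm hd hα hα1 hI]
  calc _ ≤ ∑ b, s.eveProbability α b * ⨆ b, outcomeProbability α I b :=
        Finset.sum_le_sum fun b _ => mul_le_mul_of_nonneg_left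
          (le_ciSup (Set.finite_range _).bddAbove b) (s.eveProbability_nonneg α b)
    _ = ⨆ b, outcomeProbability α I b := by
      rw [← Finset.sum_mul, sum_eveProbability hm (fun i => (hα i).ne') hI.1, one_mul]

end Guessing

section IdealStrategy

variable {d : ℕ} [NeZero d] {O : Type*} [Fintype O] [DecidableEq O] {α : Fin d → ℝ}
  {I : O → Qudit d →ₗ[ℂ] Qudit d}

lemma isPOVM_pi_single (b₀ : O) : IsPOVM (Pi.single b₀ 1 : O → ℂ →ₗ[ℂ] ℂ) := by
  refine ⟨fun b => ?_, by simp⟩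
  rcases eq_or_ne b b₀ with rfl | hb
  · simp
  · simp [hb]

/-- The strategy in which the devices are ideal and Eve always announces the outcome `b₀`. -/
def idealStrategy (hα : ∑ i, α i ^ 2 = 1) (hI : IsPOVM I) (b₀ : O) :
    Strategy d O (Qudit d) ℂ where
  toRealization := idealRealization α hα
  R := I
  E := Pi.single b₀ 1
  povm_R := hI
  povm_E := isPOVM_pi_single b₀

lemma matchesPOVM_idealStrategy (hα : ∑ i, α i ^ 2 = 1) (hI : IsPOVM I) (b₀ : O) :
    (idealStrategy hα hI b₀).MatchesPOVM α I := fun b i j => by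
  refine (expect_idealTripartite _ _ _ _).trans ?_
  rw [Module.End.one_apply, one_mul]
  rfl

lemma guess_idealStrategy (hα : ∑ i, α i ^ 2 = 1) (hI : IsPOVM I) (b₀ : O) :
    (idealStrategy hα hI b₀).guess = outcomeProbability α I b₀ := by
  have hterm : ∀ b, expect (idealTripartite α) (tri 1 (I b) ((Pi.single b₀ 1 : O → ℂ →ₗ[ℂ] ℂ) b))
      = if b = b₀ then expect (idealState α) (TensorProduct.map 1 (I b₀)) else 0 := fun b => by
    rw [expect_idealTripartite]
    rcases eq_or_ne b b₀ with rfl | hb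
    · simp
    · simp [hb]
  rw [outcomeProbability, trace_comp_reducedState]
  refine congrArg Complex.re ((Finset.sum_congr rfl fun b _ => hterm b).trans ?_)
  simp

lemma violatesMaximally_idealStrategy (hd : 2 ≤ d) (hα : ∀ i, 0 < α i) (hα1 : ∑ i, α i ^ 2 = 1)
    (hI : IsPOVM I) (b₀ : O) : (idealStrategy hα1 hI b₀).ViolatesMaximally α :=
  (Realization.violatesMaximally_iff hd hα hα1 _).2 (value_idealRealization hd hα hα1)

end IdealStrategy

section GuessingProbability

variable {d : ℕ} {O : Type*} {α : Fin d → ℝ} {I : O → Qudit d →ₗ[ℂ] Qudit d}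

lemma iSup_outcomeProbability_eq [Nonempty O]
    (htr : ∀ b, LinearMap.trace ℂ (Qudit d) (I b ∘ₗ reducedState (idealState α))
      = 1 / (d : ℂ) ^ 2) : ⨆ b, outcomeProbability α I b = 1 / (d : ℝ) ^ 2 := by
  have hp : ∀ b, outcomeProbability α I b = 1 / (d : ℝ) ^ 2 := fun b => by
    rw [outcomeProbability, htr, ← Complex.ofReal_natCast, ← Complex.ofReal_pow,
      ← Complex.ofReal_one, ← Complex.ofReal_div, Complex.ofReal_re]
  simp only [hp, ciSup_const]

variable [Fintype O]

theorem isGreatest_guessValues (hd : 2 ≤ d) (hα : ∀ i, 0 < α i) (hα1 : ∑ i, α i ^ 2 = 1)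
    (hI : IsExtremalPOVM I) :
    IsGreatest (guessValues α I) (⨆ b, outcomeProbability α I b) := by
  classical
  have : NeZero d := ⟨by omega⟩
  have := hI.1.nonempty
  obtain ⟨b₀, hb₀⟩ := exists_eq_ciSup_of_finite (f := outcomeProbability α I)
  refine ⟨⟨Qudit d, ℂ, inferInstance, inferInstance, inferInstance, inferInstance, inferInstance,
    inferInstance, idealStrategy hα1 hI.1 b₀, violatesMaximally_idealStrategy hd hα hα1 hI.1 b₀,
    matchesPOVM_idealStrategy hα1 hI.1 b₀, ?_⟩, ?_⟩
  · rw [guess_idealStrategy, hb₀]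
  · rintro _ ⟨HB, HE, _, _, _, _, _, _, s, hv, hm, rfl⟩
    exact Strategy.guess_le hv hm hd hα hα1 hI

lemma certifiedBits_eq_two_mul_logb [NeZero d] (hI : IsPOVM I)
    (htr : ∀ b, LinearMap.trace ℂ (Qudit d) (I b ∘ₗ reducedState (idealState α))
      = 1 / (d : ℂ) ^ 2)
    (h : IsGreatest (guessValues α I) (⨆ b, outcomeProbability α I b)) :
    IsLUB (guessValues α I) (1 / (d : ℝ) ^ 2) ∧
      guessingProbability α I = 1 / (d : ℝ) ^ 2 ∧
      certifiedBits α I = 2 * Real.logb 2 d := by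
  have := hI.nonempty
  rw [iSup_outcomeProbability_eq htr] at h
  have hG : guessingProbability α I = 1 / (d : ℝ) ^ 2 := h.csSup_eq
  refine ⟨h.isLUB, hG, ?_⟩
  rw [certifiedBits, hG, one_div, Real.logb_inv, neg_neg, Real.logb_pow, Nat.cast_ofNat]

end GuessingProbability

section RankOne

variable {H : Type*} [NormedAddCommGroup H] [InnerProductSpace ℂ H]

lemma exists_eq_smul_ketbra {T : H →ₗ[ℂ] H} (hT : T.IsSymmetric) {w : H}
    (h : ∀ x, ⟪w, x⟫_ℂ = 0 → T x = 0) : ∃ c : ℂ, T = c • ketbra w w := by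
  by_cases hw : w = 0
  · exact ⟨0, by ext x; simpa using h x (by simp [hw])⟩
  have hw0 : ⟪w, w⟫_ℂ ≠ 0 := inner_self_ne_zero.2 hw
  have hTx : ∀ x, T x = (⟪w, x⟫_ℂ / ⟪w, w⟫_ℂ) • T w := fun x => by
    have hx := h (x - (⟪w, x⟫_ℂ / ⟪w, w⟫_ℂ) • w) (by
      rw [inner_sub_right, inner_smul_right, div_mul_cancel₀ _ hw0, sub_self])
    rwa [map_sub, map_smul, sub_eq_zero] at hx
  have hTw : T w = (⟪w, T w⟫_ℂ / ⟪w, w⟫_ℂ) • w := by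
    refine ext_inner_right ℂ fun y => ?_
    rw [hT, hTx y, inner_smul_left, inner_smul_right, map_div₀, inner_conj_symm, inner_conj_symm,
      hT w w]
    ring
  refine ⟨⟪w, T w⟫_ℂ / ⟪w, w⟫_ℂ ^ 2, LinearMap.ext fun x => ?_⟩
  rw [LinearMap.smul_apply, ketbra_apply, hTx x, hTw, smul_smul, smul_smul]
  congr 1
  rw [inner_smul_right]
  field_simp

lemma apply_eq_zero_of_smul_add_smul_eq_zero [FiniteDimensional ℂ H] {S T : H →ₗ[ℂ] H}
    (hS : S.IsPositive) (hT : T.IsPositive) {s t : ℝ} (hs : 0 < s) (ht : 0 ≤ t) {x : H}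
    (h : (s • S + t • T) x = 0) : S x = 0 := by
  have hre : s * RCLike.re ⟪x, S x⟫_ℂ + t * RCLike.re ⟪x, T x⟫_ℂ = 0 := by
    simpa [inner_add_right, ← Complex.coe_smul, inner_smul_right] using
      congrArg (fun y => RCLike.re ⟪x, y⟫_ℂ) h
  have hS0 := hS.re_inner_nonneg_right x
  have hT0 := mul_nonneg ht (hT.re_inner_nonneg_right x)
  refine apply_eq_zero_of_re_inner_eq_zero hS (le_antisymm ?_ hS0)
  exact nonpos_of_mul_nonpos_right (by linarith) hs

lemma isExtremalPOVM_of_linearIndependent_ketbra {O : Type*} [Fintype O] [FiniteDimensional ℂ H]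
    {w : O → H} (hw : IsPOVM fun b => ketbra (w b) (w b))
    (hli : LinearIndependent ℂ fun b => ketbra (w b) (w b)) :
    IsExtremalPOVM fun b => ketbra (w b) (w b) := by
  refine ⟨hw, ?_⟩
  rintro N hN N' hN' ⟨s, t, hs, ht, -, hst⟩
  have hker : ∀ b x, ⟪w b, x⟫_ℂ = 0 → N b x = 0 := fun b x hx => by
    refine apply_eq_zero_of_smul_add_smul_eq_zero (hN.1 b) (hN'.1 b) hs ht.le ?_
    have hb := LinearMap.congr_fun (congrFun hst b) x
    rwa [ketbra_apply, hx, zero_smul] at hb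
  choose c hc using fun b => exists_eq_smul_ketbra (hN.1 b).isSymmetric (hker b)
  have hsum : ∑ b, (c b - 1) • ketbra (w b) (w b) = 0 := by
    simp only [sub_smul, one_smul, Finset.sum_sub_distrib, ← hc, hN.2, hw.2, sub_self]
  funext b
  rw [hc b, sub_eq_zero.1 (Fintype.linearIndependent_iff.1 hli _ hsum b), one_smul]

end RankOne

section Weyl

variable {d : ℕ}

lemma weylPOVM_eq_smul_ketbra (ν : Qudit d) (b : Fin d × Fin d) :
    weylPOVM ν b = (1 / d : ℂ) • ketbra (U b.1 b.2 ν) (U b.1 b.2 ν) := by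
  rw [weylPOVM]
  congr 1
  ext1 x
  simp only [LinearMap.comp_apply, ketbra_apply, map_smul, LinearMap.adjoint_inner_right]

/-- The vectors `d^(-1/2) U_{k,l} ν` onto which the elements of `weylPOVM ν` project. -/
def weylVector (ν : Qudit d) (b : Fin d × Fin d) : Qudit d :=
  ((Real.sqrt d : ℝ) : ℂ)⁻¹ • U b.1 b.2 ν

lemma weylPOVM_eq_ketbra (ν : Qudit d) :
    weylPOVM ν = fun b => ketbra (weylVector ν b) (weylVector ν b) := by
  have hsqrt : ((Real.sqrt d : ℝ) : ℂ) * ((Real.sqrt d : ℝ) : ℂ) = d := by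
    rw [← Complex.ofReal_mul, Real.mul_self_sqrt (Nat.cast_nonneg d), Complex.ofReal_natCast]
  funext b
  ext1 x
  rw [weylPOVM_eq_smul_ketbra, weylVector, LinearMap.smul_apply, ketbra_apply, ketbra_apply,
    inner_smul_left, map_inv₀, Complex.conj_ofReal, smul_smul, smul_smul, ← hsqrt]
  congr 1
  ring

variable [NeZero d]

lemma U_apply (k l : Fin d) (x : Qudit d) (i : Fin d) :
    U k l x i = phase l (i - k) * x (i - k) := by
  conv_lhs => rw [← sum_smul_ket x]
  simp [U_ket, ket_apply, ← sub_eq_iff_eq_add, mul_comm]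

lemma U_apply_U_apply (k l m n : Fin d) (x : Qudit d) :
    U m n (U k l x) = (phase n k * conj (phase l m)) • U k l (U m n x) := by
  suffices h : U m n ∘ₗ U k l = (phase n k * conj (phase l m)) • (U k l ∘ₗ U m n) from
    LinearMap.congr_fun h x
  refine linearMap_ext_ket fun i => ?_
  simp only [LinearMap.smul_apply, LinearMap.comp_apply, U_ket, map_smul, smul_smul,
    AddChar.map_add_eq_mul, add_right_comm i m k]
  congr 1
  linear_combination -(phase l i * phase n i * phase n k) * phase_mul_conj l m

lemma inner_U_U (k l : Fin d) (x y : Qudit d) : ⟪U k l x, U k l y⟫_ℂ = ⟪x, y⟫_ℂ := by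
  have hentry : ∀ i, ⟪U k l x i, U k l y i⟫_ℂ = ⟪x (i - k), y (i - k)⟫_ℂ := fun i => by
    simp only [U_apply, RCLike.inner_apply, map_mul]
    linear_combination (y (i - k) * conj (x (i - k))) * phase_mul_conj l (i - k)
  simp only [PiLp.inner_apply, hentry]
  exact Equiv.sum_comp (Equiv.subRight k) fun i => ⟪x i, y i⟫_ℂ

lemma sum_weylPOVM (ν : Qudit d) : ∑ b, weylPOVM ν b = ⟪ν, ν⟫_ℂ • 1 := by
  have hd : (d : ℂ) ≠ 0 := Nat.cast_ne_zero.2 (NeZero.ne d)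
  have hentry : ∀ k l i j : Fin d, ⟪ket i, weylPOVM ν (k, l) (ket j)⟫_ℂ = (1 / d) *
      (phase l (i - k) * conj (phase l (j - k)) * (ν (i - k) * conj (ν (j - k)))) := by
    intro k l i j
    rw [weylPOVM_eq_smul_ketbra, LinearMap.smul_apply, ketbra_apply, inner_smul_right,
      inner_smul_right, ← inner_conj_symm _ (ket j), inner_ket, inner_ket, U_apply, U_apply,
      map_mul]
    ring
  have hnorm : ∀ i, ∑ k, ν (i - k) * conj (ν (i - k)) = ⟪ν, ν⟫_ℂ := fun i =>
    Equiv.sum_comp (Equiv.subLeft i) fun j => ν j * conj (ν j)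
  refine linearMap_ext_inner_ket fun i j => ?_
  simp only [LinearMap.sum_apply, inner_sum, Fintype.sum_prod_type, hentry, ← Finset.mul_sum,
    ← Finset.sum_mul, sum_phase_mul_conj, sub_left_inj, LinearMap.smul_apply,
    Module.End.one_apply, inner_smul_right, inner_ket_ket]
  split_ifs with hij
  · subst hij
    rw [hnorm]
    field_simp
  · simp

lemma isPOVM_weylPOVM {ν : Qudit d} (hν : ‖ν‖ = 1) : IsPOVM (weylPOVM ν) := by
  refine ⟨fun b => by rw [weylPOVM_eq_ketbra]; exact isPositive_ketbra _, ?_⟩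
  rw [sum_weylPOVM, inner_self_eq_one_of_norm_eq_one hν, one_smul]

lemma trace_adjoint_U_mul_weylPOVM (ν : Qudit d) (k l m n : Fin d) :
    LinearMap.trace ℂ (Qudit d) (LinearMap.adjoint (U m n) * weylPOVM ν (k, l))
      = (1 / d) * (conj (phase n k) * phase m l * expect ν (LinearMap.adjoint (U m n))) := by
  rw [weylPOVM_eq_smul_ketbra, mul_smul_comm, map_smul, Module.End.mul_eq_comp, trace_comp_ketbra,
    LinearMap.adjoint_inner_right, U_apply_U_apply, inner_smul_left, inner_U_U, expect,
    LinearMap.adjoint_inner_right, map_mul, Complex.conj_conj, phase_comm l, smul_eq_mul]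

lemma linearIndependent_weylPOVM {ν : Qudit d}
    (hν : ∀ k l, expect ν (LinearMap.adjoint (U k l)) ≠ 0) :
    LinearIndependent ℂ (weylPOVM ν) := by
  have hd : (1 / d : ℂ) ≠ 0 := one_div_ne_zero (Nat.cast_ne_zero.2 (NeZero.ne d))
  rw [Fintype.linearIndependent_iff]
  intro c hc
  have hpair : ∀ m n, ∑ k, conj (phase n k) * ∑ l, phase m l * c (k, l) = 0 := fun m n => by
    have htrace := congrArg
      (fun T => LinearMap.trace ℂ (Qudit d) (LinearMap.adjoint (U m n) * T)) hc
    simp only [Finset.mul_sum, mul_smul_comm, map_sum, map_smul, mul_zero, map_zero,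
      Fintype.sum_prod_type, trace_adjoint_U_mul_weylPOVM, smul_eq_mul] at htrace
    refine (mul_eq_zero.1 ?_).resolve_right (mul_ne_zero hd (hν m n))
    rw [← htrace]
    simp only [Finset.sum_mul, Finset.mul_sum]
    exact Finset.sum_congr rfl fun k _ => Finset.sum_congr rfl fun l _ => by ring
  have hrow : ∀ m, (fun k => ∑ l, phase m l * c (k, l)) = 0 := fun m =>
    eq_zero_of_sum_phase_mul_eq_zero fun n => by
      simpa only [phase_comm (-n), phase_neg, Complex.conj_conj, phase_comm _ n] using hpair m (-n)
  rintro ⟨k, l⟩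
  exact congrFun (eq_zero_of_sum_phase_mul_eq_zero fun m => congrFun (hrow m) k) l

theorem isExtremalPOVM_weylPOVM {ν : Qudit d} (hν : IsWeylFiducial ν) :
    IsExtremalPOVM (weylPOVM ν) := by
  have hpovm := isPOVM_weylPOVM hν.1
  have hli := linearIndependent_weylPOVM hν.2
  rw [weylPOVM_eq_ketbra] at hpovm hli ⊢
  exact isExtremalPOVM_of_linearIndependent_ketbra hpovm hli

lemma trace_weylPOVM {ν : Qudit d} (hν : ‖ν‖ = 1) (b : Fin d × Fin d) :
    LinearMap.trace ℂ (Qudit d) (weylPOVM ν b) = 1 / d := by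
  have htrace := trace_comp_ketbra 1 (U b.1 b.2 ν) (U b.1 b.2 ν)
  rw [Module.End.one_apply, inner_U_U, inner_self_eq_one_of_norm_eq_one hν] at htrace
  rw [weylPOVM_eq_smul_ketbra, map_smul, ← LinearMap.id_comp (ketbra _ _)]
  exact (congrArg _ htrace).trans (mul_one _)

end Weyl

section MaximallyEntangled

variable {d : ℕ}

lemma maxEntangled_pos [NeZero d] (i : Fin d) : 0 < maxEntangled d i :=
  one_div_pos.2 (Real.sqrt_pos.2 (Nat.cast_pos.2 (NeZero.pos d)))

lemma maxEntangled_sq (i : Fin d) : maxEntangled d i ^ 2 = 1 / d := by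
  rw [maxEntangled, div_pow, one_pow, Real.sq_sqrt (Nat.cast_nonneg d)]

lemma sum_maxEntangled_sq [NeZero d] : ∑ i, maxEntangled d i ^ 2 = 1 := by
  simp [maxEntangled_sq, NeZero.ne d]

lemma trace_comp_reducedState_maxEntangled (T : Qudit d →ₗ[ℂ] Qudit d) :
    LinearMap.trace ℂ (Qudit d) (T ∘ₗ reducedState (idealState (maxEntangled d)))
      = (1 / d) * LinearMap.trace ℂ (Qudit d) T := by
  have hsq : ∀ i, (maxEntangled d i : ℂ) * maxEntangled d i = 1 / d := fun i => by
    rw [← sq, ← Complex.ofReal_pow, maxEntangled_sq, Complex.ofReal_div, Complex.ofReal_one,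
      Complex.ofReal_natCast]
  rw [trace_comp_reducedState, expect_map_one,
    LinearMap.trace_eq_sum_inner T (EuclideanSpace.basisFun (Fin d) ℂ), Finset.mul_sum]
  refine Finset.sum_congr rfl fun i _ => ?_
  rw [component_idealState, map_smul, inner_smul_left, inner_smul_right, Complex.conj_ofReal,
    ← mul_assoc, hsq, EuclideanSpace.basisFun_apply, ket]

end MaximallyEntangled

section Fiducial

lemma mul_sum_pow_add_mod_mul_pow {R : Type*} [CommRing R] (s y : R) {d k : ℕ} (hk : k ≤ d) :
    (y * s - 1) * ∑ m ∈ Finset.range d, s ^ ((m + k) % d) * y ^ m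
      = y ^ (d - k) * (s ^ d - 1) + s ^ k * (y ^ d - 1) := by
  obtain ⟨n, rfl⟩ := Nat.exists_eq_add_of_le' hk
  have hlow : ∑ m ∈ Finset.range n, s ^ ((m + k) % (n + k)) * y ^ m
      = s ^ k * ∑ m ∈ Finset.range n, (y * s) ^ m := by
    rw [Finset.mul_sum]
    refine Finset.sum_congr rfl fun m hm => ?_
    rw [Nat.mod_eq_of_lt (Nat.add_lt_add_right (Finset.mem_range.1 hm) k)]
    ring
  have hhigh : ∑ m ∈ Finset.range k, s ^ ((n + m + k) % (n + k)) * y ^ (n + m)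
      = y ^ n * ∑ m ∈ Finset.range k, (y * s) ^ m := by
    rw [Finset.mul_sum]
    refine Finset.sum_congr rfl fun m hm => ?_
    have hmk := Finset.mem_range.1 hm
    rw [show n + m + k = m + (n + k) by omega, Nat.add_mod_right, Nat.mod_eq_of_lt (by omega)]
    ring
  rw [Finset.sum_range_add, hlow, hhigh, Nat.add_sub_cancel]
  linear_combination s ^ k * geom_sum_mul (y * s) n + y ^ n * geom_sum_mul (y * s) k

lemma conj_pow_eq_pow_of_mul_add_mul_eq_zero {s y : ℂ} {d k : ℕ} (hs : 1 < ‖s‖) (hd : d ≠ 0)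
    (hk : k ≤ d) (hy : ‖y‖ = ‖s‖) (hyd : y ^ d = conj (s ^ d))
    (h : y ^ (d - k) * (s ^ d - 1) + s ^ k * (y ^ d - 1) = 0) : conj (s ^ d) = s ^ d := by
  have hnorm : 1 < ‖s ^ d‖ := by rw [norm_pow]; exact one_lt_pow₀ hs hd
  have hne : ‖s ^ d - 1‖ ≠ 0 := norm_ne_zero_iff.2 <| sub_ne_zero.2 fun h1 => by
    rw [h1, norm_one] at hnorm
    exact hnorm.false
  have hconj : ‖y ^ d - 1‖ = ‖s ^ d - 1‖ := by
    rw [hyd, ← map_one (starRingEnd ℂ), ← map_sub, RCLike.norm_conj, map_one]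
  have hneg := eq_neg_of_add_eq_zero_left h
  have hhalf : d - k = k := by
    have hpow := congrArg norm hneg
    rw [norm_neg, norm_mul, norm_mul, norm_pow, norm_pow, hconj, hy] at hpow
    exact pow_right_injective₀ (zero_lt_one.trans hs) hs.ne' (mul_right_cancel₀ hne hpow)
  obtain rfl : d = k * 2 := by omega
  have hsq := congrArg (· ^ 2) hneg
  simp only [hhalf, neg_sq, mul_pow, ← pow_mul, hyd] at hsq
  have hfactor :
      (s ^ (k * 2) * conj (s ^ (k * 2)) - 1) * (conj (s ^ (k * 2)) - s ^ (k * 2)) = 0 := by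
    linear_combination -hsq
  refine sub_eq_zero.1 ((mul_eq_zero.1 hfactor).resolve_left fun h1 => ?_)
  rw [sub_eq_zero, Complex.mul_conj'] at h1
  have : ‖s ^ (k * 2)‖ ^ 2 = 1 := by exact_mod_cast h1
  exact (one_lt_pow₀ hnorm two_ne_zero).ne' this

variable {d : ℕ}

/-- The vector with components `s^i`, whose autocorrelations are sums of two geometric series. -/
def geometricVector (d : ℕ) (s : ℂ) : Qudit d := WithLp.toLp 2 fun i => s ^ (i : ℕ)

lemma geometricVector_apply (s : ℂ) (i : Fin d) : geometricVector d s i = s ^ (i : ℕ) := rfl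

variable [NeZero d]

lemma expect_adjoint_U (ν : Qudit d) (k l : Fin d) :
    expect ν (LinearMap.adjoint (U k l))
      = ∑ m, conj (phase l m) * (ν (m + k) * conj (ν m)) := by
  rw [expect, LinearMap.adjoint_inner_right, PiLp.inner_apply]
  refine (Equiv.sum_comp (Equiv.addRight k) fun i => ν i * conj (U k l ν i)).symm.trans ?_
  refine Finset.sum_congr rfl fun m _ => ?_
  rw [Equiv.coe_addRight, U_apply, add_sub_cancel_right, map_mul]
  ring

lemma expect_geometricVector (s : ℂ) (k l : Fin d) :
    expect (geometricVector d s) (LinearMap.adjoint (U k l))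
      = ∑ m ∈ Finset.range d, s ^ ((m + k) % d) * conj (omega d ^ (l : ℕ) * s) ^ m := by
  rw [expect_adjoint_U, ← Fin.sum_univ_eq_sum_range
    fun m => s ^ ((m + k) % d) * conj (omega d ^ (l : ℕ) * s) ^ m]
  refine Finset.sum_congr rfl fun m _ => ?_
  simp only [geometricVector_apply, phase_apply, Fin.val_add, map_mul, map_pow]
  ring

lemma expect_geometricVector_ne_zero {s : ℂ} (hs : 1 < ‖s‖) (hconj : conj (s ^ d) ≠ s ^ d)
    (k l : Fin d) : expect (geometricVector d s) (LinearMap.adjoint (U k l)) ≠ 0 := by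
  intro h
  have homega : ‖omega d‖ = 1 := isPrimitiveRoot_omega.norm'_eq_one (NeZero.ne d)
  have hroot : (omega d ^ (l : ℕ)) ^ d = 1 := by
    rw [← pow_mul, mul_comm, pow_mul, isPrimitiveRoot_omega.pow_eq_one, one_pow]
  have hgeom := mul_sum_pow_add_mod_mul_pow s (conj (omega d ^ (l : ℕ) * s)) k.2.le
  rw [← expect_geometricVector, h, mul_zero] at hgeom
  refine hconj (conj_pow_eq_pow_of_mul_add_mul_eq_zero hs (NeZero.ne d) k.2.le ?_ ?_ hgeom.symm)
  · rw [RCLike.norm_conj, norm_mul, norm_pow, homega, one_pow, one_mul]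
  · rw [← map_pow, mul_pow, hroot, one_mul]

theorem exists_isWeylFiducial : ∃ ν : Qudit d, IsWeylFiducial ν := by
  obtain ⟨s, hs⟩ := IsAlgClosed.exists_pow_nat_eq (2 * Complex.I) (NeZero.pos d)
  have hnorm : 1 < ‖s‖ := by
    refine (one_lt_pow_iff_of_nonneg (norm_nonneg s) (NeZero.ne d)).1 ?_
    simp [← norm_pow, hs]
  have hexpect := expect_geometricVector_ne_zero (d := d) hnorm <| by
    rw [hs]
    norm_num [Complex.ext_iff]
  have hv : geometricVector d s ≠ 0 := fun h => hexpect 0 0 (by simp [h, expect])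
  have hc : (‖geometricVector d s‖ : ℂ)⁻¹ ≠ 0 := by simpa using hv
  refine ⟨(‖geometricVector d s‖ : ℂ)⁻¹ • geometricVector d s, norm_smul_inv_norm hv, fun k l => ?_⟩
  rw [expect, map_smul, inner_smul_left, inner_smul_right]
  exact mul_ne_zero (by simpa using hv) (mul_ne_zero hc (hexpect k l))

end Fiducial

end Steering

end

theorem mainTheorem5_general (d : ℕ) (hd : 2 ≤ d) :
    (∀ (O : Type*) [Fintype O] (α : Fin d → ℝ) (I : O → Steering.Qudit d →ₗ[ℂ] Steering.Qudit d),
      (∀ i, 0 < α i) → ∑ i, α i ^ 2 = 1 →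
      Steering.IsExtremalPOVM I →
      IsGreatest (Steering.guessValues α I) (⨆ b, Steering.outcomeProbability α I b)) ∧
    (∀ ν : Steering.Qudit d, Steering.IsWeylFiducial ν →
      Steering.IsExtremalPOVM (Steering.weylPOVM ν) ∧
      ∀ b, LinearMap.trace ℂ (Steering.Qudit d)
        (Steering.weylPOVM ν b ∘ₗ
          Steering.reducedState (Steering.idealState (Steering.maxEntangled d)))
            = 1 / (d : ℂ) ^ 2) ∧
    ∃ ν : Steering.Qudit d, Steering.IsWeylFiducial ν := by
  have : NeZero d := ⟨by omega⟩
  refine ⟨fun O _ α I hα hα1 hI => Steering.isGreatest_guessValues hd hα hα1 hI,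
    fun ν hν => ⟨Steering.isExtremalPOVM_weylPOVM hν, fun b => ?_⟩,
    Steering.exists_isWeylFiducial⟩
  rw [Steering.trace_comp_reducedState_maxEntangled, Steering.trace_weylPOVM hν.1, ← one_div_pow,
    sq]

theorem mainTheorem5 (d : ℕ) (hd : 2 ≤ d) :
    -- an arbitrary extremal POVM with `d²` outcomes and an arbitrary target state
    (∀ (O : Type*) [Fintype O] (α : Fin d → ℝ) (I : O → Steering.Qudit d →ₗ[ℂ] Steering.Qudit d),
      Fintype.card O = d ^ 2 →
      (∀ i, 0 < α i) → ∑ i, α i ^ 2 = 1 →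
      Steering.IsExtremalPOVM I →
      (∀ b, LinearMap.trace ℂ (Steering.Qudit d)
        (I b ∘ₗ Steering.reducedState (Steering.idealState α)) = 1 / (d : ℂ) ^ 2) →
      IsLUB (Steering.guessValues α I) (1 / (d : ℝ) ^ 2) ∧
      Steering.guessingProbability α I = 1 / (d : ℝ) ^ 2 ∧
      Steering.certifiedBits α I = 2 * Real.logb 2 d) ∧
    -- the maximally entangled state and the Weyl-covariant POVM
    (∀ ν : Steering.Qudit d, Steering.IsWeylFiducial ν →
      Steering.IsExtremalPOVM (Steering.weylPOVM ν) ∧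
      (∀ b, LinearMap.trace ℂ (Steering.Qudit d)
        (Steering.weylPOVM ν b ∘ₗ
          Steering.reducedState (Steering.idealState (Steering.maxEntangled d)))
            = 1 / (d : ℂ) ^ 2) ∧
      IsLUB (Steering.guessValues (Steering.maxEntangled d) (Steering.weylPOVM ν))
        (1 / (d : ℝ) ^ 2) ∧
      Steering.guessingProbability (Steering.maxEntangled d) (Steering.weylPOVM ν)
        = 1 / (d : ℝ) ^ 2 ∧
      Steering.certifiedBits (Steering.maxEntangled d) (Steering.weylPOVM ν)
        = 2 * Real.logb 2 d) ∧
    (∃ ν : Steering.Qudit d, Steering.IsWeylFiducial ν) := by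
  have : NeZero d := ⟨by omega⟩
  obtain ⟨hgreatest, hweyl, hfiducial⟩ := mainTheorem5_general d hd
  refine ⟨fun O _ α I _ hα hα1 hI htr => Steering.certifiedBits_eq_two_mul_logb hI.1 htr
    ((mainTheorem5_general d hd).1 O α I hα hα1 hI), fun ν hν => ?_, hfiducial⟩
  obtain ⟨hI, htr⟩ := hweyl ν hν
  exact ⟨hI, htr, Steering.certifiedBits_eq_two_mul_logb hI.1 htr (hgreatest _ _ _
    Steering.maxEntangled_pos Steering.sum_maxEntangled_sq hI)⟩
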